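/- A seller with zero costs sells two goods to a buyer whose type $\mathbf{x}=(x_1,x_2)$ has a probability density $f$ on $\mathcal X=[0,1]^2$ and who values a bundle $\mathbf{q}\in[0,1]^2$ at $\mathbf{x}\cdot\mathbf{q}$. Assume that $f$ is continuous on $\mathcal X$ and continuously differentiable on its interior, that $\phi(\mathbf{x})=\mathbf{x}\cdot\nabla f(\mathbf{x})+3f(\mathbf{x})$ extends continuously from the interior to $\mathcal X$, and that $f(\mathbf{x})>0$ for almost every point with $x_1=1$ or $x_2=1$. Assume moreover that $f$ is strictly regular and symmetric (SRS): $\phi(\mathbf{x})>0$ for almost every $\mathbf{x}\in\mathcal X$, and $f(x_1,x_2)=f(x_2,x_1)$. Define $\zeta:[0,1]\to[0,1]$ by $$\zeta(x_1)=\sup\Big\{z\in[0,1]:\int_z^1\phi(x_1,x_2)\,dx_2-f(x_1,1)\ge 0\Big\},\qquad \sup\emptyset=0.$$ A mechanism is a price schedule $p:[0,1]^2\to\mathbb R$, bounded below, with $p(0,0)=0$; its indirect utility function is $u(\mathbf{x})=\sup_{\mathbf{q}\in[0,1]^2}\{\mathbf{x}\cdot\mathbf{q}-p(\mathbf{q})\}$.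 It is optimal if it maximizes the revenue $\int_{\mathcal X}[\mathbf{x}\cdot\nabla u(\mathbf{x})-u(\mathbf{x})]f(\mathbf{x})\,d\mathbf{x}$ among all mechanisms, and symmetric if $u(x_1,x_2)=u(x_2,x_1)$ on $\mathcal X$. Let $\overline u(x)=u(x,1)$. Suppose that $\zeta$ is concave on $[0,1]$. Then for every symmetric optimal mechanism there exist $0\le b^0\le a^1<1$ such that 1. $\overline u'(x)=0$ for $x\in[0,b^0)$; 2. $\overline u(x)=1-\zeta(x)$ for $x\in[b^0,a^1)$; 3. $\overline u'(x)=1$ for $x\in[a^1,1]$. Here $\overline u'$ denotes the right derivative at $x=0$ and at $x=a^1$, the left derivative at $x=1$, and the two-sided derivative at the other points. -/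

import Mathlib

open Set MeasureTheory

noncomputable section

namespace TwoGoods

/-- The unit square `[0,1]²`: both the space of types and the space of bundles. -/
def square : Set (ℝ × ℝ) := Icc 0 1 ×ˢ Icc 0 1

/-- The interior `(0,1)²` of the square. -/
def openSquare : Set (ℝ × ℝ) := Ioo 0 1 ×ˢ Ioo 0 1

/-- The bundle `(0,0)`. -/
def zeroBundle : square := ⟨(0, 0), by simp [square]⟩

/-! ### Type distribution -/

/-- The marginal revenue density `φ(x) = x · ∇f(x) + 3 f(x)` of a density `f` that is differentiable
on the open square, extended to the closed square by limits. -/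
def mrDensity (f : ℝ × ℝ → ℝ) : ℝ × ℝ → ℝ :=
  extendFrom openSquare (fun x => fderiv ℝ f x x + 3 * f x)

/-- Standing assumptions on the density `f` of the type distribution on the unit square: it is a
probability density, it is continuous on the square and continuously differentiable in the interior,
its marginal revenue density extends continuously to the square, and it is positive at almost every
point of the top boundary (the points with `x₁ = 1` or `x₂ = 1`). -/
structure IsTypeDensity (f : ℝ × ℝ → ℝ) : Prop where
  nonneg : ∀ x ∈ square, 0 ≤ f x
  integral_eq_one : ∫ x in square, f x = 1
  continuousOn : ContinuousOn f square
  contDiffOn : ContDiffOn ℝ 1 f openSquare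
  continuousOn_mrDensity : ContinuousOn (mrDensity f) square
  pos_top : ∀ᵐ t ∂(volume.restrict (Icc (0 : ℝ) 1)), 0 < f (t, 1)
  pos_right : ∀ᵐ t ∂(volume.restrict (Icc (0 : ℝ) 1)), 0 < f (1, t)

/-- Strict regularity and symmetry (SRS). -/
structure IsSRS (f : ℝ × ℝ → ℝ) : Prop where
  regular : ∀ᵐ x ∂(volume.restrict square), 0 < mrDensity f x
  symm : ∀ x ∈ square, f x.swap = f x

/-- The threshold function
`ζ(x₁) = sup {z ∈ [0,1] : ∫_z^1 φ(x₁,x₂) dx₂ - f(x₁,1) ≥ 0}`, with `sup ∅ = 0`. -/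
def zeta (f : ℝ × ℝ → ℝ) (x₁ : ℝ) : ℝ :=
  sSup {z ∈ Icc (0 : ℝ) 1 | 0 ≤ (∫ x₂ in z..1, mrDensity f (x₁, x₂)) - f (x₁, 1)}

/-! ### Mechanisms -/

/-- Price schedules: the null bundle is free, and prices are bounded below (equivalently, every type
has a finite indirect utility). -/
structure IsPriceSchedule (p : square → ℝ) : Prop where
  zero : p zeroBundle = 0
  bddBelow : BddBelow (range p)

/-- The indirect utility `u(x) = sup_q {x · q - p(q)}` induced by the price schedule `p`. The formula
makes sense for every `x` in the plane; only its values on the square matter. -/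
def indirectUtility (p : square → ℝ) (x : ℝ × ℝ) : ℝ :=
  ⨆ q : square, (x.1 * q.1.1 + x.2 * q.1.2 - p q)

/-- The seller's total revenue `∫ [x · ∇u(x) - u(x)] f(x) dx`. -/
def totalRevenue (f : ℝ × ℝ → ℝ) (p : square → ℝ) : ℝ :=
  ∫ x in square, (fderiv ℝ (indirectUtility p) x x - indirectUtility p x) * f x

/-- Optimality: the price schedule maximizes the total revenue among all price schedules. -/
def IsOptimal (f : ℝ × ℝ → ℝ) (p : square → ℝ) : Prop :=
  IsPriceSchedule p ∧ ∀ p' : square → ℝ, IsPriceSchedule p' → totalRevenue f p' ≤ totalRevenue f p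

/-- A mechanism is symmetric if its indirect utility function is. -/
def IsSymmetric (p : square → ℝ) : Prop :=
  ∀ x ∈ square, indirectUtility p x.swap = indirectUtility p x

/-- The boundary indirect utility `ū(x₁) = u(x₁, 1)`. -/
def ubar (p : square → ℝ) (x₁ : ℝ) : ℝ := indirectUtility p (x₁, 1)

end TwoGoods

end

namespace TwoGoods

/-! Write `U` for `ubar p`. By symmetry half the revenue is an integral over the triangle above the
diagonal. Integrating by parts along rays from the origin turns it into `∫ U(s) f(s,1) ds - ∫ u φ`.
Since `φ > 0` almost everywhere, `u` should be as small as its boundary values permit, and slopes at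
most one in `x₂` together with participation give `u(x) ≥ max 0 (U(x₁) + x₂ - 1)`. The price
schedule `priceOf V` attains this bound for every convex nonnegative `V` with slopes in `[0,1]`.
Hence `U` maximizes `∫ profit f s (V s) ds` over all such `V`.

For fixed `s` the marginal profit at `v ≥ 0` is minus the excess `∫_z^1 φ(s,t) dt - f(s,1)` at `z =
max s (1 - v)`, and the excess decreases in `z`, changing sign at `ζ(s)`. So where `s < ζ(s)`,
profit peaks at `v = 1 - ζ(s)` (strictly so for almost every `s`), and where `ζ(s) < s` it increases
strictly in `v`. Testing the integration by parts on `1` and on `x₁²` shows that the excess takes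
both signs on the diagonal; with concavity, `ζ` then crosses the diagonal once, downwards, at some
`m` in `(0,1)` (`exists_zeta_crossing`).

Therefore no admissible change of `U` can go towards the convex function `w = 1 - ζ` on `(0,m)` and
upwards on `(m,1)` (`eqOn_ubar_of_profit_le`). This rigidity alone gives the structure
(`exists_pooling_structure`): comparing `U` with lines of slope one and zero, and with the largest
admissible function `W` below `w`, yields `U(x) = max(W(x), U(0), x + U(1) - 1)`. The constant
branch, the part where `W = w`, and the branch of slope one are the three regions. -/

/-! ### Continuous extension of functions on the square -/

/-- The function on the plane that agrees with `g` on the square and is constant along the fibres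
of the nearest-point projection onto the square. -/
def extendSquare (g : ℝ × ℝ → ℝ) (x : ℝ × ℝ) : ℝ :=
  g (max 0 (min 1 x.1), max 0 (min 1 x.2))

theorem clamp_mem_square (x : ℝ × ℝ) :
    ((max 0 (min 1 x.1), max 0 (min 1 x.2)) : ℝ × ℝ) ∈ square := by
  simp [square]

theorem extendSquare_eq {g : ℝ × ℝ → ℝ} {x : ℝ × ℝ} (hx : x ∈ square) :
    extendSquare g x = g x := by
  obtain ⟨⟨h1, h2⟩, h3, h4⟩ := hx
  simp [extendSquare, h1, h2, h3, h4]

theorem continuous_extendSquare {g : ℝ × ℝ → ℝ} (hg : ContinuousOn g square) :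
    Continuous (extendSquare g) :=
  hg.comp_continuous (by fun_prop) clamp_mem_square

theorem exists_bound_extendSquare {g : ℝ × ℝ → ℝ} (hg : ContinuousOn g square) :
    ∃ C, ∀ x, |extendSquare g x| ≤ C := by
  have hc : IsCompact square := isCompact_Icc.prod isCompact_Icc
  obtain ⟨C, hC⟩ := hc.exists_bound_of_continuousOn hg
  exact ⟨C, fun x => hC _ (clamp_mem_square x)⟩

theorem openSquare_subset_square : openSquare ⊆ square :=
  prod_mono Ioo_subset_Icc_self Ioo_subset_Icc_self

theorem isOpen_openSquare : IsOpen openSquare := isOpen_Ioo.prod isOpen_Ioo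

/-! ### The marginal revenue density along rays -/

theorem mrDensity_eq {f : ℝ × ℝ → ℝ} (hf : ContDiffOn ℝ 1 f openSquare) {x : ℝ × ℝ}
    (hx : x ∈ openSquare) : mrDensity f x = fderiv ℝ f x x + 3 * f x := by
  have h1 : ContinuousOn (fun x => fderiv ℝ f x x + 3 * f x) openSquare :=
    ((hf.continuousOn_fderiv_of_isOpen isOpen_openSquare le_rfl).clm_apply continuousOn_id).add
      (continuousOn_const.mul hf.continuousOn)
  exact extendFrom_eq (subset_closure hx) (h1 x hx)

/-- The velocity of the ray is `(s, 1)`, and `r • (s, 1)` is the point itself, so `r` times the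
derivative is `x · ∇f = φ - 3f`. -/
theorem hasDerivAt_ray {f : ℝ × ℝ → ℝ} (hf : ContDiffOn ℝ 1 f openSquare) {s r : ℝ}
    (hs : s ∈ Ioo (0 : ℝ) 1) (hr : r ∈ Ioo (0 : ℝ) 1) :
    HasDerivAt (fun ρ : ℝ => f (ρ * s, ρ))
      ((mrDensity f (r * s, r) - 3 * f (r * s, r)) / r) r := by
  have hx : ((r * s, r) : ℝ × ℝ) ∈ openSquare :=
    ⟨⟨mul_pos hr.1 hs.1, by nlinarith [hr.1, hr.2, hs.1, hs.2]⟩, hr⟩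
  have hd : DifferentiableAt ℝ f (r * s, r) :=
    (hf.differentiableOn one_ne_zero).differentiableAt (isOpen_openSquare.mem_nhds hx)
  have hl : HasDerivAt (fun ρ : ℝ => ((ρ * s, ρ) : ℝ × ℝ)) (s, 1) r := by
    simpa using ((hasDerivAt_id r).mul_const s).prodMk (hasDerivAt_id r)
  have := HasFDerivAt.comp_hasDerivAt (f := fun ρ : ℝ => ((ρ * s, ρ) : ℝ × ℝ)) r hd.hasFDerivAt hl
  refine this.congr_deriv ?_
  rw [mrDensity_eq hf hx]
  have : ((r * s, r) : ℝ × ℝ) = r • (s, 1) := by simp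
  have h2 : ∀ L : ℝ × ℝ →L[ℝ] ℝ, L (r * s, r) = r * L (s, 1) := fun L => by
    rw [this, map_smul, smul_eq_mul]
  rw [h2]
  have := hr.1.ne'
  field_simp
  ring

/-! ### Integration over the triangle above the diagonal -/

/-- The open triangle `0 < x₁ < x₂ < 1`. -/
def triangle : Set (ℝ × ℝ) := {x | 0 < x.1 ∧ x.1 < x.2 ∧ x.2 < 1}

theorem isOpen_triangle : IsOpen triangle :=
  (isOpen_lt continuous_const continuous_fst).inter
    ((isOpen_lt continuous_fst continuous_snd).inter (isOpen_lt continuous_snd continuous_const))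

theorem measurableSet_triangle : MeasurableSet triangle := isOpen_triangle.measurableSet

theorem triangle_subset_openSquare : triangle ⊆ openSquare := fun _ hx =>
  ⟨⟨hx.1, hx.2.1.trans hx.2.2⟩, hx.1.trans hx.2.1, hx.2.2⟩

theorem triangle_subset_square : triangle ⊆ square :=
  triangle_subset_openSquare.trans openSquare_subset_square

theorem isCompact_square : IsCompact square := isCompact_Icc.prod isCompact_Icc

theorem measurableSet_square : MeasurableSet square := isCompact_square.measurableSet

theorem volume_square_lt_top : volume square < ⊤ := isCompact_square.measure_lt_top

theorem integrableOn_square_of_bounded {G : ℝ × ℝ → ℝ} (hG : Measurable G) {C : ℝ}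
    (hC : ∀ x ∈ square, |G x| ≤ C) : IntegrableOn G square :=
  Measure.integrableOn_of_bounded volume_square_lt_top.ne hG.aestronglyMeasurable
    ((ae_restrict_iff' measurableSet_square).2 (.of_forall hC))

theorem indicator_triangle_left (G : ℝ × ℝ → ℝ) (x y : ℝ) :
    triangle.indicator G (x, y) =
      (Ioo (0 : ℝ) 1).indicator (fun x => (Ioo x 1).indicator (fun y => G (x, y)) y) x := by
  by_cases h : (x, y) ∈ triangle
  · have h' : 0 < x ∧ x < y ∧ y < 1 := h
    rw [indicator_of_mem h, indicator_of_mem (show x ∈ Ioo (0 : ℝ) 1 from ⟨h'.1, h'.2.1.trans h'.2.2⟩),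
      indicator_of_mem (show y ∈ Ioo x 1 from h'.2)]
  · rw [indicator_of_notMem h]
    symm
    by_cases hx : x ∈ Ioo (0 : ℝ) 1
    · rw [indicator_of_mem hx, indicator_of_notMem]
      exact fun hy => h ⟨hx.1, hy.1, hy.2⟩
    · rw [indicator_of_notMem hx]

theorem indicator_triangle_right (G : ℝ × ℝ → ℝ) (x y : ℝ) :
    triangle.indicator G (x, y) =
      (Ioo (0 : ℝ) 1).indicator (fun y => (Ioo 0 y).indicator (fun x => G (x, y)) x) y := by
  by_cases h : (x, y) ∈ triangle
  · have h' : 0 < x ∧ x < y ∧ y < 1 := h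
    rw [indicator_of_mem h, indicator_of_mem (show y ∈ Ioo (0 : ℝ) 1 from ⟨h'.1.trans h'.2.1, h'.2.2⟩),
      indicator_of_mem (show x ∈ Ioo 0 y from ⟨h'.1, h'.2.1⟩)]
  · rw [indicator_of_notMem h]
    symm
    by_cases hy : y ∈ Ioo (0 : ℝ) 1
    · rw [indicator_of_mem hy, indicator_of_notMem]
      exact fun hx => h ⟨hx.1, hx.2, hy.2⟩
    · rw [indicator_of_notMem hy]

theorem integral_indicator_triangle_left (G : ℝ × ℝ → ℝ) (x : ℝ) :
    ∫ y, triangle.indicator G (x, y) =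
      (Ioo (0 : ℝ) 1).indicator (fun x => ∫ y in Ioo x 1, G (x, y)) x := by
  simp_rw [indicator_triangle_left]
  by_cases hx : x ∈ Ioo (0 : ℝ) 1
  · simp_rw [indicator_of_mem hx, integral_indicator measurableSet_Ioo]
  · simp_rw [indicator_of_notMem hx, integral_zero]

theorem integral_indicator_triangle_right (G : ℝ × ℝ → ℝ) (y : ℝ) :
    ∫ x, triangle.indicator G (x, y) =
      (Ioo (0 : ℝ) 1).indicator (fun y => ∫ x in Ioo 0 y, G (x, y)) y := by
  simp_rw [indicator_triangle_right]
  by_cases hx : y ∈ Ioo (0 : ℝ) 1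
  · simp_rw [indicator_of_mem hx, integral_indicator measurableSet_Ioo]
  · simp_rw [indicator_of_notMem hx, integral_zero]

theorem integral_triangle_vertical {G : ℝ × ℝ → ℝ} (hG : IntegrableOn G triangle) :
    ∫ x in triangle, G x = ∫ x in Ioo (0 : ℝ) 1, ∫ y in Ioo x 1, G (x, y) := by
  rw [← integral_indicator measurableSet_triangle, Measure.volume_eq_prod,
    integral_prod _ ((integrable_indicator_iff measurableSet_triangle).2 hG)]
  simp_rw [integral_indicator_triangle_left]
  rw [integral_indicator measurableSet_Ioo]

theorem integrableOn_triangle_vertical {G : ℝ × ℝ → ℝ} (hG : IntegrableOn G triangle) :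
    IntegrableOn (fun x => ∫ y in Ioo x 1, G (x, y)) (Ioo (0 : ℝ) 1) := by
  have := ((integrable_indicator_iff measurableSet_triangle).2 hG).integral_prod_left
  simp_rw [integral_indicator_triangle_left] at this
  rwa [integrable_indicator_iff measurableSet_Ioo] at this

theorem integral_triangle_horizontal {G : ℝ × ℝ → ℝ} (hG : IntegrableOn G triangle) :
    ∫ x in triangle, G x = ∫ y in Ioo (0 : ℝ) 1, ∫ x in Ioo 0 y, G (x, y) := by
  rw [← integral_indicator measurableSet_triangle, Measure.volume_eq_prod,
    integral_prod_symm _ ((integrable_indicator_iff measurableSet_triangle).2 hG)]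
  simp_rw [integral_indicator_triangle_right]
  rw [integral_indicator measurableSet_Ioo]

theorem ray_mem_square {s r : ℝ} (hs : s ∈ Ioo (0 : ℝ) 1) (hr : r ∈ Ioo (0 : ℝ) 1) :
    ((r * s, r) : ℝ × ℝ) ∈ square :=
  ⟨⟨(mul_pos hr.1 hs.1).le, by nlinarith [hr.1, hr.2, hs.1, hs.2]⟩, hr.1.le, hr.2.le⟩

theorem integral_Ioo_eq_scaled (F : ℝ → ℝ) {y : ℝ} (hy : 0 < y) :
    ∫ x in Ioo 0 y, F x = ∫ s in Ioo (0 : ℝ) 1, y * F (y * s) := by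
  rw [← integral_Ioc_eq_integral_Ioo, ← integral_Ioc_eq_integral_Ioo,
    ← intervalIntegral.integral_of_le hy.le, ← intervalIntegral.integral_of_le zero_le_one]
  have := intervalIntegral.smul_integral_comp_mul_left (a := 0) (b := 1) F y
  simp only [mul_zero, mul_one, smul_eq_mul] at this
  rw [← this, intervalIntegral.integral_const_mul]

/-- The substitution `x₁ = y s` in each horizontal slice has Jacobian `y`. After exchanging the
order of integration the inner integral runs along a ray from the origin. -/
theorem integral_triangle_rays {G : ℝ × ℝ → ℝ} (hG : Measurable G) {C : ℝ}
    (hC : ∀ x ∈ square, |G x| ≤ C) :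
    ∫ x in triangle, G x =
      ∫ s in Ioo (0 : ℝ) 1, ∫ r in Ioo (0 : ℝ) 1, r * G (r * s, r) := by
  rw [integral_triangle_horizontal
    ((integrableOn_square_of_bounded hG hC).mono_set triangle_subset_square)]
  have h1 : ∫ y in Ioo (0 : ℝ) 1, ∫ x in Ioo 0 y, G (x, y) =
      ∫ y in Ioo (0 : ℝ) 1, ∫ s in Ioo (0 : ℝ) 1, y * G (y * s, y) :=
    setIntegral_congr_fun measurableSet_Ioo fun y hy =>
      integral_Ioo_eq_scaled (fun x => G (x, y)) hy.1
  rw [h1, integral_integral_swap]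
  rw [Measure.prod_restrict]
  have hC0 : 0 ≤ C := (abs_nonneg _).trans (hC (0, 0) (by simp [square]))
  refine Measure.integrableOn_of_bounded (M := C) ?_ ?_ ?_
  · have : Ioo (0 : ℝ) 1 ×ˢ Ioo (0 : ℝ) 1 ⊆ square := openSquare_subset_square
    exact ((measure_mono this).trans_lt volume_square_lt_top).ne
  · exact (measurable_fst.mul (hG.comp (by fun_prop))).aestronglyMeasurable
  · refine (ae_restrict_iff' (measurableSet_Ioo.prod measurableSet_Ioo)).2 (.of_forall ?_)
    rintro ⟨r, s⟩ ⟨hr, hs⟩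
    have := hC _ (ray_mem_square hs hr)
    simp only [Function.uncurry_apply_pair, Real.norm_eq_abs, abs_mul, abs_of_pos hr.1]
    nlinarith [abs_nonneg (G (r * s, r)), hr.2, hr.1]

/-- Fubini gives the property on almost every horizontal line; scaling by `r ≠ 0` preserves null
sets, and a second use of Fubini exchanges `r` and `s`. -/
theorem ae_ray_of_ae {P : ℝ × ℝ → Prop} (hm : MeasurableSet {x | P x}) (h : ∀ᵐ x, P x) :
    ∀ᵐ s ∂volume.restrict (Ioo (0 : ℝ) 1), ∀ᵐ r ∂volume.restrict (Ioo (0 : ℝ) 1),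
      P (r * s, r) := by
  have hN : MeasurableSet {x : ℝ × ℝ | ¬ P (x.2 * x.1, x.2)} :=
    (hm.compl).preimage (show Measurable fun x : ℝ × ℝ => ((x.2 * x.1, x.2) : ℝ × ℝ) by fun_prop)
  have key : ∀ᵐ r ∂volume.restrict (Ioo (0 : ℝ) 1), ∀ᵐ s ∂volume.restrict (Ioo (0 : ℝ) 1),
      P (r * s, r) := by
    have h' : ∀ᵐ x ∂((volume : Measure ℝ).prod volume), P x.swap :=
      (Measure.measurePreserving_swap (μ := (volume : Measure ℝ))
        (ν := (volume : Measure ℝ))).quasiMeasurePreserving.ae h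
    have h2 := Measure.ae_ae_of_ae_prod h'
    refine (ae_restrict_iff' measurableSet_Ioo).2 ?_
    filter_upwards [h2] with r hr hr0
    refine ae_restrict_of_ae ?_
    have h3 : Measure.map (r * ·) (volume : Measure ℝ) = ENNReal.ofReal |r⁻¹| • volume :=
      Real.map_volume_mul_left hr0.1.ne'
    have h4 : ∀ᵐ x ∂(Measure.map (r * ·) (volume : Measure ℝ)), P (x, r) := by
      rw [h3]
      exact Measure.ae_smul_measure hr _
    exact ae_of_ae_map (p := fun x => P (x, r)) (by fun_prop) h4
  have : ∀ᵐ z ∂((volume.restrict (Ioo (0 : ℝ) 1)).prod (volume.restrict (Ioo (0 : ℝ) 1))),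
      P (z.1 * z.2, z.1) := by
    refine (Measure.ae_prod_iff_ae_ae ?_).2 key
    exact hm.preimage (show Measurable fun x : ℝ × ℝ => ((x.1 * x.2, x.1) : ℝ × ℝ) by fun_prop)
  have h' := (Measure.measurePreserving_swap (μ := volume.restrict (Ioo (0 : ℝ) 1))
        (ν := volume.restrict (Ioo (0 : ℝ) 1))).quasiMeasurePreserving.ae this
  exact Measure.ae_ae_of_ae_prod h'

/-! ### Integration by parts along rays -/

/-- The product rule gives `(r² f)' = 2 r f + r (φ - 3 f) = r φ - r f`. Continuity up to the
boundary lets the fundamental theorem of calculus reach the endpoints. -/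
theorem sq_mul_extendSquare_ray {f : ℝ × ℝ → ℝ} (hf : IsTypeDensity f) {s : ℝ}
    (hs : s ∈ Ioo (0 : ℝ) 1) {r : ℝ} (hr : r ∈ Icc (0 : ℝ) 1) :
    ∫ ρ in (0 : ℝ)..r, (ρ * extendSquare (mrDensity f) (ρ * s, ρ) -
      ρ * extendSquare f (ρ * s, ρ)) = r ^ 2 * extendSquare f (r * s, r) := by
  have hF := continuous_extendSquare hf.continuousOn
  have hΦ := continuous_extendSquare hf.continuousOn_mrDensity
  have hd : ∀ x ∈ Ioo 0 r, HasDerivAt (fun r : ℝ => r ^ 2 * extendSquare f (r * s, r))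
      (x * extendSquare (mrDensity f) (x * s, x) - x * extendSquare f (x * s, x)) x := by
    intro x hx
    have hx' : x ∈ Ioo (0 : ℝ) 1 := ⟨hx.1, hx.2.trans_le hr.2⟩
    have h1 : HasDerivAt (fun ρ : ℝ => extendSquare f (ρ * s, ρ))
        ((mrDensity f (x * s, x) - 3 * f (x * s, x)) / x) x := by
      refine (hasDerivAt_ray hf.contDiffOn hs hx').congr_of_eventuallyEq ?_
      filter_upwards [isOpen_Ioo.mem_nhds hx'] with ρ hρ
      exact extendSquare_eq (ray_mem_square hs hρ)
    refine ((hasDerivAt_pow 2 x).mul h1).congr_deriv ?_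
    rw [extendSquare_eq (ray_mem_square hs hx'), extendSquare_eq (ray_mem_square hs hx')]
    have := hx'.1.ne'
    simp only [Nat.cast_ofNat, Nat.add_one_sub_one, pow_one]
    field_simp
    ring
  have hcont : Continuous fun x : ℝ => x * extendSquare (mrDensity f) (x * s, x) -
      x * extendSquare f (x * s, x) := by fun_prop
  rw [intervalIntegral.integral_eq_sub_of_hasDerivAt_of_le hr.1
    (Continuous.continuousOn (by fun_prop)) hd (hcont.intervalIntegrable 0 r)]
  ring

theorem integral_ray {f : ℝ × ℝ → ℝ} (hf : IsTypeDensity f) {s : ℝ} (hs : s ∈ Ioo (0 : ℝ) 1)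
    {y : ℝ → ℝ} {K : NNReal} (hy : LipschitzWith K y) :
    ∫ r in Ioo (0 : ℝ) 1, r * ((r * deriv y r - y r) * extendSquare f (r * s, r)) =
      y 1 * f (s, 1) - ∫ r in Ioo (0 : ℝ) 1, r * (y r * extendSquare (mrDensity f) (r * s, r)) := by
  have hF := continuous_extendSquare hf.continuousOn
  have hΦ := continuous_extendSquare hf.continuousOn_mrDensity
  -- The primitive of `ψ` stands in for `r² f`: it is absolutely continuous with derivative `ψ`
  -- everywhere, while the two agree only on `[0,1]`.
  set ψ : ℝ → ℝ := fun ρ => ρ * extendSquare (mrDensity f) (ρ * s, ρ) -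
      ρ * extendSquare f (ρ * s, ρ) with hψdef
  have hψ : Continuous ψ := by fun_prop
  have hk : ∀ r ∈ Icc (0 : ℝ) 1, ∫ ρ in (0 : ℝ)..r, ψ ρ = r ^ 2 * extendSquare f (r * s, r) :=
    fun r hr => sq_mul_extendSquare_ray hf hs hr
  have hkd : ∀ r, deriv (fun r => ∫ ρ in (0 : ℝ)..r, ψ ρ) r = ψ r := fun r =>
    hψ.deriv_integral ψ 0 r
  have hkac : AbsolutelyContinuousOnInterval (fun r => ∫ ρ in (0 : ℝ)..r, ψ ρ) 0 1 :=
    (hψ.intervalIntegrable 0 1).absolutelyContinuousOnInterval_intervalIntegral (by simp)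
  have hyac : AbsolutelyContinuousOnInterval y 0 1 :=
    (hy.lipschitzOnWith (s := uIcc 0 1)).absolutelyContinuousOnInterval
  have key := hkac.integral_mul_deriv_eq_deriv_mul hyac
  simp_rw [hkd] at key
  rw [hk 1 (by simp), hk 0 (by simp)] at key
  have hyc := hy.continuous
  have e1 : ∫ r in (0 : ℝ)..1, (∫ ρ in (0 : ℝ)..r, ψ ρ) * deriv y r =
      ∫ r in (0 : ℝ)..1, r ^ 2 * extendSquare f (r * s, r) * deriv y r := by
    refine intervalIntegral.integral_congr fun r hr => ?_
    rw [uIcc_of_le zero_le_one] at hr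
    simp only [hk r hr]
  rw [e1] at key
  have hi1 : IntervalIntegrable (fun r => r ^ 2 * extendSquare f (r * s, r) * deriv y r)
      volume 0 1 :=
    hyac.intervalIntegrable_deriv.continuousOn_mul (Continuous.continuousOn (by fun_prop))
  have hi2 : IntervalIntegrable (fun r => r * (y r * extendSquare f (r * s, r))) volume 0 1 :=
    Continuous.intervalIntegrable (by fun_prop) _ _
  have hi3 : IntervalIntegrable (fun r => r * (y r * extendSquare (mrDensity f) (r * s, r)))
      volume 0 1 := Continuous.intervalIntegrable (by fun_prop) _ _
  have e2 : ∫ r in (0 : ℝ)..1, ψ r * y r =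
      (∫ r in (0 : ℝ)..1, r * (y r * extendSquare (mrDensity f) (r * s, r))) -
        ∫ r in (0 : ℝ)..1, r * (y r * extendSquare f (r * s, r)) := by
    rw [← intervalIntegral.integral_sub hi3 hi2]
    refine intervalIntegral.integral_congr fun r _ => ?_
    simp only [hψdef]
    ring
  rw [e2] at key
  have hs1 : ((1 * s, 1) : ℝ × ℝ) ∈ square := by
    simp [square, hs.1.le, hs.2.le]
  rw [extendSquare_eq hs1] at key
  rw [← integral_Ioc_eq_integral_Ioo, ← integral_Ioc_eq_integral_Ioo,
    ← intervalIntegral.integral_of_le zero_le_one, ← intervalIntegral.integral_of_le zero_le_one]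
  have e3 : ∫ r in (0 : ℝ)..1, r * ((r * deriv y r - y r) * extendSquare f (r * s, r)) =
      (∫ r in (0 : ℝ)..1, r ^ 2 * extendSquare f (r * s, r) * deriv y r) -
        ∫ r in (0 : ℝ)..1, r * (y r * extendSquare f (r * s, r)) := by
    rw [← intervalIntegral.integral_sub hi1 hi2]
    refine intervalIntegral.integral_congr fun r _ => ?_
    ring
  rw [e3, key]
  simp
  ring

theorem measurable_fderiv_self (u : ℝ × ℝ → ℝ) : Measurable fun x => fderiv ℝ u x x := by
  have : (fun x : ℝ × ℝ => fderiv ℝ u x x) =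
      fun x => x.1 * fderiv ℝ u x (1, 0) + x.2 * fderiv ℝ u x (0, 1) := by
    funext x
    have hx : x = x.1 • ((1, 0) : ℝ × ℝ) + x.2 • ((0, 1) : ℝ × ℝ) := by ext <;> simp
    have : ∀ L : ℝ × ℝ →L[ℝ] ℝ, L x = x.1 * L (1, 0) + x.2 * L (0, 1) := fun L => by
      have := congrArg L hx
      rwa [map_add, map_smul, map_smul, smul_eq_mul, smul_eq_mul] at this
    exact this _
  rw [this]
  exact (measurable_fst.mul (measurable_fderiv_apply_const ℝ u _)).add
    (measurable_snd.mul (measurable_fderiv_apply_const ℝ u _))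

theorem norm_le_one_of_mem_square {x : ℝ × ℝ} (hx : x ∈ square) : ‖x‖ ≤ 1 := by
  obtain ⟨⟨h1, h2⟩, h3, h4⟩ := hx
  simp [Prod.norm_def, abs_of_nonneg, h1, h2, h3, h4]

theorem exists_bound_revenue {u : ℝ × ℝ → ℝ} {K : NNReal} (hu : LipschitzWith K u) :
    ∃ C, ∀ x ∈ square, |fderiv ℝ u x x - u x| ≤ C := by
  obtain ⟨C, hC⟩ := isCompact_square.exists_bound_of_continuousOn hu.continuous.continuousOn
  refine ⟨K + C, fun x hx => (abs_sub _ _).trans (add_le_add ?_ (hC x hx))⟩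
  calc |fderiv ℝ u x x| ≤ ‖fderiv ℝ u x‖ * ‖x‖ := (fderiv ℝ u x).le_opNorm x
    _ ≤ K * 1 := mul_le_mul (norm_fderiv_le_of_lipschitz ℝ hu) (norm_le_one_of_mem_square hx)
        (norm_nonneg _) K.2
    _ = K := mul_one _

theorem lipschitzWith_ray {u : ℝ × ℝ → ℝ} {K : NNReal} (hu : LipschitzWith K u) {s : ℝ}
    (hs : s ∈ Ioo (0 : ℝ) 1) : LipschitzWith K fun ρ : ℝ => u (ρ * s, ρ) := by
  have : LipschitzWith 1 fun ρ : ℝ => ((ρ * s, ρ) : ℝ × ℝ) := by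
    refine LipschitzWith.of_dist_le_mul fun x y => ?_
    simp only [Prod.dist_eq, NNReal.coe_one, one_mul, Real.dist_eq, ← sub_mul, abs_mul,
      abs_of_pos hs.1]
    exact max_le (mul_le_of_le_one_right (abs_nonneg _) hs.2.le) le_rfl
  have h := hu.comp this
  rw [mul_one] at h
  exact h

theorem integral_triangle_revenue {f : ℝ × ℝ → ℝ} (hf : IsTypeDensity f) {u : ℝ × ℝ → ℝ}
    {K : NNReal} (hu : LipschitzWith K u) :
    ∫ x in triangle, (fderiv ℝ u x x - u x) * f x =
      (∫ s in Ioo (0 : ℝ) 1, u (s, 1) * f (s, 1)) - ∫ x in triangle, u x * mrDensity f x := by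
  have hF := continuous_extendSquare hf.continuousOn
  have hΦ := continuous_extendSquare hf.continuousOn_mrDensity
  have huc := hu.continuous
  have h1 : ∫ x in triangle, (fderiv ℝ u x x - u x) * f x =
      ∫ x in triangle, (fderiv ℝ u x x - u x) * extendSquare f x :=
    setIntegral_congr_fun measurableSet_triangle fun x hx => by
      simp only [extendSquare_eq (triangle_subset_square hx)]
  have h2 : ∫ x in triangle, u x * mrDensity f x =
      ∫ x in triangle, u x * extendSquare (mrDensity f) x :=
    setIntegral_congr_fun measurableSet_triangle fun x hx => by
      simp only [extendSquare_eq (triangle_subset_square hx)]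
  obtain ⟨C₁, hC₁⟩ := exists_bound_revenue hu
  obtain ⟨C₂, hC₂⟩ := exists_bound_extendSquare hf.continuousOn
  have hc : Continuous fun x => u x * extendSquare (mrDensity f) x := by fun_prop
  obtain ⟨C₃, hC₃⟩ := isCompact_square.exists_bound_of_continuousOn hc.continuousOn
  rw [h1, h2, integral_triangle_rays (C := C₁ * C₂)
      (G := fun x => (fderiv ℝ u x x - u x) * extendSquare f x)
      (((measurable_fderiv_self u).sub huc.measurable).mul hF.measurable)
      (fun x hx => by
        rw [abs_mul]
        exact mul_le_mul (hC₁ x hx) (hC₂ x) (abs_nonneg _) ((abs_nonneg _).trans (hC₁ x hx))),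
    integral_triangle_rays hc.measurable hC₃]
  -- Rademacher's theorem, transferred to rays: on almost every ray the radial derivative of `u` is
  -- given by its gradient at almost every point.
  have hdiff := ae_ray_of_ae (measurableSet_of_differentiableAt ℝ u) hu.ae_differentiableAt
  have h3 : ∫ s in Ioo (0 : ℝ) 1, ∫ r in Ioo (0 : ℝ) 1,
      r * ((fderiv ℝ u (r * s, r) (r * s, r) - u (r * s, r)) * extendSquare f (r * s, r)) =
      ∫ s in Ioo (0 : ℝ) 1, (u (s, 1) * f (s, 1) - ∫ r in Ioo (0 : ℝ) 1,
        r * (u (r * s, r) * extendSquare (mrDensity f) (r * s, r))) := by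
    refine integral_congr_ae ?_
    filter_upwards [hdiff, ae_restrict_mem measurableSet_Ioo] with s hs hs0
    have := integral_ray hf hs0 (lipschitzWith_ray hu hs0)
    simp only [one_mul] at this
    rw [← this]
    refine integral_congr_ae ?_
    filter_upwards [hs] with r hr
    have hl : HasDerivAt (fun ρ : ℝ => ((ρ * s, ρ) : ℝ × ℝ)) (s, 1) r := by
      simpa using ((hasDerivAt_id r).mul_const s).prodMk (hasDerivAt_id r)
    have hd := HasFDerivAt.comp_hasDerivAt (f := fun ρ : ℝ => ((ρ * s, ρ) : ℝ × ℝ)) r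
      (DifferentiableAt.hasFDerivAt hr) hl
    have hd' : deriv (fun ρ : ℝ => u (ρ * s, ρ)) r = fderiv ℝ u (r * s, r) (s, 1) := hd.deriv
    have h2 : ∀ L : ℝ × ℝ →L[ℝ] ℝ, L (r * s, r) = r * L (s, 1) := fun L => by
      rw [show ((r * s, r) : ℝ × ℝ) = r • (s, 1) by simp, map_smul, smul_eq_mul]
    rw [hd', h2]
  rw [h3, integral_sub]
  · have : Continuous fun s : ℝ => u (s, 1) * extendSquare f (s, 1) := by fun_prop
    have hi := (this.continuousOn (s := Icc 0 1)).integrableOn_compact isCompact_Icc (μ := volume)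
    refine (hi.mono_set Ioo_subset_Icc_self).congr_fun (fun s hs => ?_) measurableSet_Ioo
    have : ((s, 1) : ℝ × ℝ) ∈ square := by simp [square, hs.1.le, hs.2.le]
    simp only [extendSquare_eq this]
  · have hi : Integrable (fun z : ℝ × ℝ =>
        z.2 * (u (z.2 * z.1, z.2) * extendSquare (mrDensity f) (z.2 * z.1, z.2)))
        ((volume.restrict (Ioo (0 : ℝ) 1)).prod (volume.restrict (Ioo (0 : ℝ) 1))) := by
      rw [Measure.prod_restrict]
      have hc : Continuous fun z : ℝ × ℝ =>
        z.2 * (u (z.2 * z.1, z.2) * extendSquare (mrDensity f) (z.2 * z.1, z.2)) := by fun_prop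
      exact (hc.continuousOn.integrableOn_compact isCompact_square (μ := volume)).mono_set
        openSquare_subset_square
    exact hi.integral_prod_left

/-! ### Indirect utility functions -/

theorem bddAbove_indirectUtility {p : square → ℝ} (hp : BddBelow (range p)) (x : ℝ × ℝ) :
    BddAbove (range fun q : square => x.1 * q.1.1 + x.2 * q.1.2 - p q) := by
  obtain ⟨m, hm⟩ := hp
  refine ⟨|x.1| + |x.2| - m, ?_⟩
  rintro _ ⟨q, rfl⟩
  obtain ⟨⟨h1, h2⟩, h3, h4⟩ := q.2
  have hq := hm ⟨q, rfl⟩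
  have e1 : x.1 * q.1.1 ≤ |x.1| :=
    (mul_le_mul_of_nonneg_right (le_abs_self _) h1).trans (mul_le_of_le_one_right (abs_nonneg _) h2)
  have e2 : x.2 * q.1.2 ≤ |x.2| :=
    (mul_le_mul_of_nonneg_right (le_abs_self _) h3).trans (mul_le_of_le_one_right (abs_nonneg _) h4)
  simp only
  linarith

theorem le_indirectUtility {p : square → ℝ} (hp : BddBelow (range p)) (x : ℝ × ℝ) (q : square) :
    x.1 * q.1.1 + x.2 * q.1.2 - p q ≤ indirectUtility p x :=
  le_ciSup (bddAbove_indirectUtility hp x) q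

theorem indirectUtility_le {p : square → ℝ} {x : ℝ × ℝ} {c : ℝ}
    (h : ∀ q : square, x.1 * q.1.1 + x.2 * q.1.2 - p q ≤ c) : indirectUtility p x ≤ c :=
  have : Nonempty square := ⟨zeroBundle⟩
  ciSup_le h

/-- Both coordinates of a bundle are at most one, whence the constant 2 for the sup norm. This
regularity is what permits integration by parts along rays. -/
theorem lipschitzWith_indirectUtility {p : square → ℝ} (hp : BddBelow (range p)) :
    LipschitzWith 2 (indirectUtility p) := by
  refine LipschitzWith.of_le_add_mul 2 fun x y => indirectUtility_le fun q => ?_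
  have hq := le_indirectUtility hp y q
  obtain ⟨⟨h1, h2⟩, h3, h4⟩ := q.2
  have d1 : |x.1 - y.1| ≤ dist x y := le_max_left _ _
  have d2 : |x.2 - y.2| ≤ dist x y := le_max_right _ _
  have e1 : (x.1 - y.1) * q.1.1 ≤ |x.1 - y.1| :=
    (mul_le_mul_of_nonneg_right (le_abs_self _) h1).trans (mul_le_of_le_one_right (abs_nonneg _) h2)
  have e2 : (x.2 - y.2) * q.1.2 ≤ |x.2 - y.2| :=
    (mul_le_mul_of_nonneg_right (le_abs_self _) h3).trans (mul_le_of_le_one_right (abs_nonneg _) h4)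
  simp only [NNReal.coe_ofNat]
  linarith

theorem indirectUtility_nonneg {p : square → ℝ} (hp : IsPriceSchedule p) (x : ℝ × ℝ) :
    0 ≤ indirectUtility p x := by
  have h := le_indirectUtility hp.bddBelow x zeroBundle
  rw [hp.zero] at h
  simpa [zeroBundle] using h

/-- The functions on `[0,1]` that are the restriction of an indirect utility function to the top
side of the square: convex, with slopes between `0` and `1`, and nonnegative. -/
structure IsBoundaryUtility (V : ℝ → ℝ) : Prop where
  convexOn : ConvexOn ℝ (Icc 0 1) V
  monotoneOn : MonotoneOn V (Icc 0 1)
  slope_le : ∀ x ∈ Icc (0 : ℝ) 1, ∀ y ∈ Icc (0 : ℝ) 1, x ≤ y → V y ≤ V x + (y - x)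
  nonneg : ∀ x ∈ Icc (0 : ℝ) 1, 0 ≤ V x

namespace IsBoundaryUtility

variable {V W : ℝ → ℝ}

theorem continuousOn (hV : IsBoundaryUtility V) : ContinuousOn V (Icc 0 1) := by
  have : LipschitzOnWith 1 V (Icc 0 1) := by
    refine LipschitzOnWith.of_le_add_mul 1 fun x hx y hy => ?_
    simp only [NNReal.coe_one, one_mul, Real.dist_eq]
    rcases le_total x y with h | h
    · linarith [hV.monotoneOn hx hy h, abs_nonneg (x - y)]
    · linarith [hV.slope_le y hy x hx h, le_abs_self (x - y)]
  exact this.continuousOn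

theorem sup (hV : IsBoundaryUtility V) (hW : IsBoundaryUtility W) :
    IsBoundaryUtility fun x => max (V x) (W x) where
  convexOn := hV.convexOn.sup hW.convexOn
  monotoneOn := fun _ hx _ hy h => max_le_max (hV.monotoneOn hx hy h) (hW.monotoneOn hx hy h)
  slope_le := fun x hx y hy h => max_le
    ((hV.slope_le x hx y hy h).trans (by linarith [le_max_left (V x) (W x)]))
    ((hW.slope_le x hx y hy h).trans (by linarith [le_max_right (V x) (W x)]))
  nonneg := fun x hx => (hV.nonneg x hx).trans (le_max_left _ _)

/-- The maximum with an affine function of slope in `[0,1]`. -/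
theorem sup_affine (hV : IsBoundaryUtility V) {a : ℝ} (ha : a ∈ Icc (0 : ℝ) 1) (c : ℝ) :
    IsBoundaryUtility fun x => max (V x) (a * x + c) where
  convexOn := hV.convexOn.sup <| ((convexOn_id (convex_Icc 0 1)).smul ha.1).add_const c
  monotoneOn := fun _ hx _ hy h => max_le_max (hV.monotoneOn hx hy h)
    (by linarith [mul_le_mul_of_nonneg_left h ha.1])
  slope_le := fun x hx y hy h => max_le
    ((hV.slope_le x hx y hy h).trans (by linarith [le_max_left (V x) (a * x + c)]))
    (by nlinarith [le_max_right (V x) (a * x + c), ha.2])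
  nonneg := fun x hx => (hV.nonneg x hx).trans (le_max_left _ _)

/-- For `x < 1` the right derivative, the infimum of the forward slopes, serves; at `x = 1` the
maximal slope 1 does. -/
theorem exists_subgradient (hV : IsBoundaryUtility V) {x : ℝ} (hx : x ∈ Icc (0 : ℝ) 1) :
    ∃ a ∈ Icc (0 : ℝ) 1, ∀ y ∈ Icc (0 : ℝ) 1, a * y - V y ≤ a * x - V x := by
  rcases hx.2.eq_or_lt with rfl | hx1
  · exact ⟨1, by simp, fun y hy => by linarith [hV.slope_le y hy 1 hx hy.2]⟩
  set S : Set ℝ := (fun y => (V y - V x) / (y - x)) '' Ioc x 1 with hS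
  have hpos : ∀ s ∈ S, 0 ≤ s := by
    rintro _ ⟨y, hy, rfl⟩
    exact div_nonneg (sub_nonneg.2 (hV.monotoneOn hx ⟨hx.1.trans hy.1.le, hy.2⟩ hy.1.le))
      (sub_pos.2 hy.1).le
  have hbdd : BddBelow S := ⟨0, hpos⟩
  have hne : S.Nonempty := ⟨_, 1, ⟨hx1, le_rfl⟩, rfl⟩
  refine ⟨sInf S, ⟨le_csInf hne hpos, ?_⟩, fun y hy => ?_⟩
  · refine (csInf_le hbdd ⟨1, ⟨hx1, le_rfl⟩, rfl⟩).trans ?_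
    rw [div_le_one (sub_pos.2 hx1)]
    linarith [hV.slope_le x hx 1 (by simp) hx1.le]
  · rcases lt_trichotomy y x with h | rfl | h
    · have : (V x - V y) / (x - y) ≤ sInf S := by
        refine le_csInf hne ?_
        rintro _ ⟨z, hz, rfl⟩
        exact hV.convexOn.slope_mono_adjacent hy ⟨hx.1.trans hz.1.le, hz.2⟩ h hz.1
      rw [div_le_iff₀ (sub_pos.2 h)] at this
      linarith
    · exact le_rfl
    · have : sInf S ≤ (V y - V x) / (y - x) := csInf_le hbdd ⟨y, ⟨h, hy.2⟩, rfl⟩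
      rw [le_div_iff₀ (sub_pos.2 h)] at this
      linarith

end IsBoundaryUtility

theorem isBoundaryUtility_ubar {p : square → ℝ} (hp : IsPriceSchedule p) :
    IsBoundaryUtility (ubar p) where
  convexOn := by
    refine ⟨convex_Icc 0 1, fun x _ y _ a b ha hb hab => indirectUtility_le fun q => ?_⟩
    have h1 : _ ≤ ubar p x := le_indirectUtility hp.bddBelow (x, 1) q
    have h2 : _ ≤ ubar p y := le_indirectUtility hp.bddBelow (y, 1) q
    have h1' := mul_le_mul_of_nonneg_left h1 ha
    have h2' := mul_le_mul_of_nonneg_left h2 hb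
    obtain rfl : b = 1 - a := by linarith
    simp only [smul_eq_mul] at *
    linarith
  monotoneOn := fun x _ y _ h => indirectUtility_le fun q =>
    le_trans (by
      have := mul_le_mul_of_nonneg_right h q.2.1.1
      simp only
      linarith) (le_indirectUtility hp.bddBelow (y, 1) q)
  slope_le := fun x _ y _ h => indirectUtility_le fun q => by
    have h1 : _ ≤ ubar p x := le_indirectUtility hp.bddBelow (x, 1) q
    have := mul_le_mul_of_nonneg_left q.2.1.2 (sub_nonneg.2 h)
    simp only at *
    linarith
  nonneg := fun x _ => indirectUtility_nonneg hp _

/-- A bundle contains at most one unit of the second good, so lowering `x₂` from 1 loses at most `1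
- x₂`; the null bundle guarantees 0. -/
theorem ubar_le_indirectUtility {p : square → ℝ} (hp : IsPriceSchedule p) {x : ℝ × ℝ}
    (hx : x.2 ≤ 1) : max 0 (ubar p x.1 + x.2 - 1) ≤ indirectUtility p x := by
  refine max_le (indirectUtility_nonneg hp x) ?_
  have : ubar p x.1 ≤ indirectUtility p x + (1 - x.2) := indirectUtility_le fun q => by
    have h1 := le_indirectUtility hp.bddBelow x q
    have := mul_le_mul_of_nonneg_left q.2.2.2 (sub_nonneg.2 hx)
    simp only
    linarith
  linarith

/-! ### Price schedules implementing a boundary utility -/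

/-- The convex conjugate of a function on `[0,1]`. -/
noncomputable def conjugate (V : ℝ → ℝ) (a : ℝ) : ℝ := ⨆ x : Icc (0 : ℝ) 1, (a * x - V x)

open Classical in
/-- A price schedule whose indirect utility function is the smallest symmetric one with the given
restriction `V` to the top side of the square. -/
noncomputable def priceOf (V : ℝ → ℝ) (q : square) : ℝ :=
  if q = zeroBundle then 0
  else if q.1.2 = 1 then 1 + conjugate V q.1.1
  else if q.1.1 = 1 then 1 + conjugate V q.1.2
  else 2

theorem le_conjugate {V : ℝ → ℝ} (hV : IsBoundaryUtility V) {a x : ℝ} (ha : a ∈ Icc (0 : ℝ) 1) (hx : x ∈ Icc (0 : ℝ) 1) :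
    a * x - V x ≤ conjugate V a := by
  refine le_ciSup (f := fun x : Icc (0 : ℝ) 1 => a * x - V x) ⟨1, ?_⟩ ⟨x, hx⟩
  rintro _ ⟨y, rfl⟩
  simp only
  nlinarith [hV.nonneg y y.2, y.2.1, y.2.2, ha.1, ha.2]

theorem exists_conjugate_eq {V : ℝ → ℝ} (hV : IsBoundaryUtility V) {x : ℝ} (hx : x ∈ Icc (0 : ℝ) 1) :
    ∃ a ∈ Icc (0 : ℝ) 1, conjugate V a ≤ a * x - V x := by
  obtain ⟨a, ha, h⟩ := hV.exists_subgradient hx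
  have : Nonempty (Icc (0 : ℝ) 1) := ⟨⟨x, hx⟩⟩
  exact ⟨a, ha, ciSup_le fun y => h y y.2⟩

theorem isPriceSchedule_priceOf {V : ℝ → ℝ} (hV : IsBoundaryUtility V) : IsPriceSchedule (priceOf V) where
  zero := by simp [priceOf]
  bddBelow := by
    have h0 := hV.nonneg 0 (by simp)
    refine ⟨-V 0, ?_⟩
    rintro _ ⟨q, rfl⟩
    have h1 := le_conjugate hV q.2.1 (show (0 : ℝ) ∈ Icc (0 : ℝ) 1 by simp)
    have h2 := le_conjugate hV q.2.2 (show (0 : ℝ) ∈ Icc (0 : ℝ) 1 by simp)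
    unfold priceOf
    split_ifs <;> linarith

/-- This is Fenchel biconjugation: the bundles `(a, 1)` yield `sup_a (a x₁ - V*(a)) + x₂ - 1 = V(x₁)
+ x₂ - 1`, with the supremum attained at a subgradient, and the bundles `(1, a)` yield the mirror
image. -/
theorem indirectUtility_priceOf {V : ℝ → ℝ} (hV : IsBoundaryUtility V) {x : ℝ × ℝ} (hx : x ∈ square) :
    indirectUtility (priceOf V) x = max 0 (max (V x.1 + x.2 - 1) (V x.2 + x.1 - 1)) := by
  have hp := isPriceSchedule_priceOf hV
  refine le_antisymm (indirectUtility_le fun q => ?_)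
    (max_le (indirectUtility_nonneg hp x) (max_le ?_ ?_))
  · have h1 := le_conjugate hV q.2.1 hx.1
    have h2 := le_conjugate hV q.2.2 hx.2
    unfold priceOf
    split_ifs with c1 c2 c3
    · simp [c1, zeroBundle]
    · refine le_max_of_le_right (le_max_of_le_left ?_)
      rw [c2]
      linarith
    · refine le_max_of_le_right (le_max_of_le_right ?_)
      rw [c3]
      linarith
    -- No type values a bundle above 2, so bundles at the default price 2 never beat the null
    -- bundle.
    · refine le_max_of_le_left ?_
      obtain ⟨⟨h1, h2⟩, h3, h4⟩ := q.2
      obtain ⟨⟨k1, k2⟩, k3, k4⟩ := hx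
      nlinarith
  · obtain ⟨a, ha, h⟩ := exists_conjugate_eq hV hx.1
    have hq := le_indirectUtility hp.bddBelow x ⟨(a, 1), ⟨ha, by simp⟩⟩
    have hne : (⟨(a, 1), ⟨ha, by simp⟩⟩ : square) ≠ zeroBundle := fun h => by
      simpa [zeroBundle] using congrArg (fun q : square => q.1.2) h
    simp only [priceOf, if_neg hne, if_true] at hq
    linarith
  · obtain ⟨a, ha, h⟩ := exists_conjugate_eq hV hx.2
    have hq := le_indirectUtility hp.bddBelow x ⟨(1, a), ⟨by simp, ha⟩⟩
    have hne : (⟨(1, a), ⟨by simp, ha⟩⟩ : square) ≠ zeroBundle := fun h => by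
      simpa [zeroBundle] using congrArg (fun q : square => q.1.1) h
    simp only [priceOf, if_neg hne, if_true] at hq
    split_ifs at hq with c
    -- For `a = 1` the bundle is `(1, 1)`, priced by the earlier branch; both formulas agree there.
    · subst c
      linarith
    · linarith

theorem isSymmetric_priceOf {V : ℝ → ℝ} (hV : IsBoundaryUtility V) : IsSymmetric (priceOf V) := fun x hx => by
  rw [indirectUtility_priceOf hV hx, indirectUtility_priceOf hV ⟨hx.2, hx.1⟩]
  simp only [Prod.fst_swap, Prod.snd_swap, max_comm]

theorem indirectUtility_priceOf_of_le {V : ℝ → ℝ} (hV : IsBoundaryUtility V) {x : ℝ × ℝ} (hx : x ∈ square) (h : x.1 ≤ x.2) :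
    indirectUtility (priceOf V) x = max 0 (V x.1 + x.2 - 1) := by
  rw [indirectUtility_priceOf hV hx, max_eq_left (a := V x.1 + x.2 - 1)]
  linarith [hV.slope_le x.1 hx.1 x.2 hx.2 h]

theorem ubar_priceOf {V : ℝ → ℝ} (hV : IsBoundaryUtility V) {x : ℝ} (hx : x ∈ Icc (0 : ℝ) 1) : ubar (priceOf V) x = V x := by
  have := indirectUtility_priceOf_of_le hV (x := (x, 1)) ⟨hx, by simp⟩ hx.2
  simpa [ubar, hV.nonneg x hx] using this

/-! ### Revenue as a functional of the boundary utility -/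

theorem square_ae_eq_triangles :
    square =ᵐ[volume] (triangle ∪ Prod.swap ⁻¹' triangle : Set (ℝ × ℝ)) := by
  have h1 : ∀ c : ℝ, ∀ᵐ x : ℝ × ℝ, x.1 ≠ c := fun c =>
    (Measure.quasiMeasurePreserving_fst (μ := (volume : Measure ℝ)) (ν := volume)).ae
      (Measure.ae_ne volume c)
  have h2 : ∀ c : ℝ, ∀ᵐ x : ℝ × ℝ, x.2 ≠ c := fun c =>
    (Measure.quasiMeasurePreserving_snd (μ := (volume : Measure ℝ)) (ν := volume)).ae
      (Measure.ae_ne volume c)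
  have h3 : ∀ᵐ x : ℝ × ℝ, x.1 ≠ x.2 := by
    refine (Measure.ae_prod_iff_ae_ae ?_).2 (.of_forall fun x => ?_)
    · exact (measurableSet_eq_fun measurable_fst measurable_snd).compl
    · filter_upwards [Measure.ae_ne volume x] with y hy using hy.symm
  filter_upwards [h1 0, h1 1, h2 0, h2 1, h3] with x a0 a1 b0 b1 hne
  refine propext ⟨fun hx => ?_, ?_⟩
  · obtain ⟨⟨k1, k2⟩, k3, k4⟩ := hx
    rcases lt_or_gt_of_ne hne with h | h
    · exact Or.inl ⟨lt_of_le_of_ne k1 a0.symm, h, lt_of_le_of_ne k4 b1⟩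
    · exact Or.inr ⟨lt_of_le_of_ne k3 b0.symm, h, lt_of_le_of_ne k2 a1⟩
  · rintro (hx | hx)
    · exact triangle_subset_square hx
    · exact ⟨(triangle_subset_square hx).2, (triangle_subset_square hx).1⟩

theorem integral_square_of_symmetric {G : ℝ × ℝ → ℝ} (hG : IntegrableOn G square)
    (hs : ∀ x ∈ triangle, G x.swap = G x) :
    ∫ x in square, G x = 2 * ∫ x in triangle, G x := by
  have hG' := hG.congr_set_ae square_ae_eq_triangles.symm
  rw [setIntegral_congr_set square_ae_eq_triangles, setIntegral_union _
    (measurableSet_triangle.preimage measurable_swap) (hG'.mono_set subset_union_left)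
    (hG'.mono_set subset_union_right)]
  · have : ∫ x in Prod.swap ⁻¹' triangle, G x = ∫ x in triangle, G x := by
      have h := (Measure.measurePreserving_swap (μ := (volume : Measure ℝ))
        (ν := (volume : Measure ℝ))).setIntegral_preimage_emb
        MeasurableEquiv.prodComm.measurableEmbedding (fun x => G x.swap) triangle
      simp only [Prod.swap_swap] at h
      exact h.trans (setIntegral_congr_fun measurableSet_triangle hs)
    rw [this]
    ring
  · rw [disjoint_left]
    exact fun x hx hx' => lt_asymm hx.2.1 hx'.2.1

theorem fderiv_swap_self {u : ℝ × ℝ → ℝ} (hu : ∀ x ∈ square, u x.swap = u x) {x : ℝ × ℝ}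
    (hx : x ∈ openSquare) : fderiv ℝ u x.swap x.swap = fderiv ℝ u x x := by
  have h : (u ∘ ContinuousLinearEquiv.prodComm ℝ ℝ ℝ) =ᶠ[nhds x] u := by
    filter_upwards [isOpen_openSquare.mem_nhds hx] with y hy
    exact hu y (openSquare_subset_square hy)
  rw [← h.fderiv_eq, ContinuousLinearEquiv.comp_right_fderiv]
  rfl

theorem totalRevenue_eq {f : ℝ × ℝ → ℝ} (hf : IsTypeDensity f) (hsf : ∀ x ∈ square, f x.swap = f x)
    {p : square → ℝ} (hp : IsPriceSchedule p) (hsp : IsSymmetric p) :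
    totalRevenue f p = 2 * ((∫ s in Ioo (0 : ℝ) 1, ubar p s * f (s, 1)) -
      ∫ x in triangle, indirectUtility p x * mrDensity f x) := by
  have hu := lipschitzWith_indirectUtility hp.bddBelow
  have hF := continuous_extendSquare hf.continuousOn
  unfold totalRevenue
  rw [integral_square_of_symmetric, integral_triangle_revenue hf hu]
  · rfl
  · obtain ⟨C₁, hC₁⟩ := exists_bound_revenue hu
    obtain ⟨C₂, hC₂⟩ := exists_bound_extendSquare hf.continuousOn
    have := integrableOn_square_of_bounded (C := C₁ * C₂)
      (G := fun x => (fderiv ℝ (indirectUtility p) x x - indirectUtility p x) * extendSquare f x)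
      (((measurable_fderiv_self _).sub hu.continuous.measurable).mul hF.measurable)
      (fun x hx => by
        rw [abs_mul]
        exact mul_le_mul (hC₁ x hx) (hC₂ x) (abs_nonneg _) ((abs_nonneg _).trans (hC₁ x hx)))
    exact this.congr_fun (fun x hx => by simp only [extendSquare_eq hx]) measurableSet_square
  · intro x hx
    rw [fderiv_swap_self hsp (triangle_subset_openSquare hx), hsp x (triangle_subset_square hx),
      hsf x (triangle_subset_square hx)]

/-- The contribution to (half of) the revenue of the vertical segment above the diagonal through
`(s, 0)`, if `(s, 1)` has indirect utility `v` and the types below it have the least indirect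
utility this permits. -/
noncomputable def profit (f : ℝ × ℝ → ℝ) (s v : ℝ) : ℝ :=
  v * f (s, 1) - ∫ t in Ioo s 1, max 0 (v + t - 1) * mrDensity f (s, t)

theorem integrableOn_boundary {f : ℝ × ℝ → ℝ} (hf : IsTypeDensity f) {V : ℝ → ℝ}
    (hV : ContinuousOn V (Icc 0 1)) :
    IntegrableOn (fun s => V s * f (s, 1)) (Ioo (0 : ℝ) 1) := by
  have h : ContinuousOn (fun s => V s * f (s, 1)) (Icc (0 : ℝ) 1) :=
    hV.mul (hf.continuousOn.comp (by fun_prop) fun s hs => ⟨hs, by simp⟩)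
  exact (h.integrableOn_compact isCompact_Icc).mono_set Ioo_subset_Icc_self

theorem integrableOn_lowest {f : ℝ × ℝ → ℝ} (hf : IsTypeDensity f) {V : ℝ → ℝ}
    (hV : ContinuousOn V (Icc 0 1)) :
    IntegrableOn (fun x : ℝ × ℝ => max 0 (V x.1 + x.2 - 1) * mrDensity f x) triangle := by
  have h1 : ContinuousOn (fun x : ℝ × ℝ => V x.1) square :=
    hV.comp continuousOn_fst fun x hx => hx.1
  have h : ContinuousOn (fun x : ℝ × ℝ => max 0 (V x.1 + x.2 - 1) * mrDensity f x) square :=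
    (continuousOn_const.sup ((h1.add continuousOn_snd).sub continuousOn_const)).mul
      hf.continuousOn_mrDensity
  exact (h.integrableOn_compact isCompact_square).mono_set triangle_subset_square

theorem integrableOn_profit {f : ℝ × ℝ → ℝ} (hf : IsTypeDensity f) {V : ℝ → ℝ}
    (hV : ContinuousOn V (Icc 0 1)) :
    IntegrableOn (fun s => profit f s (V s)) (Ioo (0 : ℝ) 1) :=
  (integrableOn_boundary hf hV).sub (integrableOn_triangle_vertical (integrableOn_lowest hf hV))

theorem integral_profit {f : ℝ × ℝ → ℝ} (hf : IsTypeDensity f) {V : ℝ → ℝ}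
    (hV : ContinuousOn V (Icc 0 1)) :
    ∫ s in Ioo (0 : ℝ) 1, profit f s (V s) = (∫ s in Ioo (0 : ℝ) 1, V s * f (s, 1)) -
      ∫ x in triangle, max 0 (V x.1 + x.2 - 1) * mrDensity f x := by
  rw [integral_triangle_vertical (integrableOn_lowest hf hV), ← integral_sub
    (integrableOn_boundary hf hV) (integrableOn_triangle_vertical (integrableOn_lowest hf hV))]
  rfl

/-- Since `φ > 0` almost everywhere, replacing `u` by its lower bound in terms of `ubar p` can only
raise revenue. -/
theorem totalRevenue_le {f : ℝ × ℝ → ℝ} (hf : IsTypeDensity f) (hs : IsSRS f)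
    {p : square → ℝ} (hp : IsPriceSchedule p) (hsp : IsSymmetric p) :
    totalRevenue f p ≤ 2 * ∫ s in Ioo (0 : ℝ) 1, profit f s (ubar p s) := by
  have hV := (isBoundaryUtility_ubar hp).continuousOn
  rw [totalRevenue_eq hf hs.symm hp hsp, integral_profit hf hV]
  have hi : IntegrableOn (fun x => indirectUtility p x * mrDensity f x) triangle :=
    (((lipschitzWith_indirectUtility hp.bddBelow).continuous.continuousOn.mul
      hf.continuousOn_mrDensity).integrableOn_compact isCompact_square).mono_set
        triangle_subset_square
  have : ∫ x in triangle, max 0 (ubar p x.1 + x.2 - 1) * mrDensity f x ≤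
      ∫ x in triangle, indirectUtility p x * mrDensity f x := by
    refine integral_mono_ae (integrableOn_lowest hf hV) hi ?_
    filter_upwards [ae_restrict_of_ae_restrict_of_subset triangle_subset_square hs.regular,
      ae_restrict_mem measurableSet_triangle] with x hx hxT
    exact mul_le_mul_of_nonneg_right (ubar_le_indirectUtility hp hxT.2.2.le) hx.le
  linarith

theorem totalRevenue_priceOf {f : ℝ × ℝ → ℝ} (hf : IsTypeDensity f) (hs : IsSRS f)
    {V : ℝ → ℝ} (hV : IsBoundaryUtility V) :
    totalRevenue f (priceOf V) = 2 * ∫ s in Ioo (0 : ℝ) 1, profit f s (V s) := by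
  rw [totalRevenue_eq hf hs.symm (isPriceSchedule_priceOf hV) (isSymmetric_priceOf hV),
    integral_profit hf hV.continuousOn]
  congr 2
  · exact setIntegral_congr_fun measurableSet_Ioo fun s hs => by
      simp only [ubar_priceOf hV (Ioo_subset_Icc_self hs)]
  · exact setIntegral_congr_fun measurableSet_triangle fun x hx => by
      simp only [indirectUtility_priceOf_of_le hV (triangle_subset_square hx) hx.2.1.le]

/-- The two-dimensional problem reduces here to a one-dimensional one: the upper bound on revenue is
attained by `priceOf V`, so the boundary utility of `p` must itself maximize. -/
theorem integral_profit_le_of_isOptimal {f : ℝ × ℝ → ℝ} (hf : IsTypeDensity f) (hs : IsSRS f)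
    {p : square → ℝ} (hp : IsOptimal f p) (hsp : IsSymmetric p) {V : ℝ → ℝ}
    (hV : IsBoundaryUtility V) :
    ∫ s in Ioo (0 : ℝ) 1, profit f s (V s) ≤ ∫ s in Ioo (0 : ℝ) 1, profit f s (ubar p s) := by
  have h1 := hp.2 _ (isPriceSchedule_priceOf hV)
  rw [totalRevenue_priceOf hf hs hV] at h1
  linarith [totalRevenue_le hf hs hp.1 hsp]

/-! ### The largest boundary utility below a convex function -/

/-- The two conditions say that `W` is the infimal convolution of `w` with the positive part. The
positive part is convex with slopes in `[0,1]`, and `W` inherits both properties. -/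
theorem IsBoundaryUtility.of_infConvolution {w W : ℝ → ℝ} (hw : ConvexOn ℝ (Icc 0 1) w)
    (hw0 : ∀ x ∈ Icc (0 : ℝ) 1, 0 ≤ w x)
    (hle : ∀ x ∈ Icc (0 : ℝ) 1, ∀ y ∈ Icc (0 : ℝ) 1, W x ≤ w y + max 0 (x - y))
    (hatt : ∀ x ∈ Icc (0 : ℝ) 1, ∃ y ∈ Icc (0 : ℝ) 1, w y + max 0 (x - y) ≤ W x) :
    IsBoundaryUtility W where
  convexOn := by
    refine ⟨convex_Icc 0 1, fun x hx y hy a b ha hb hab => ?_⟩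
    obtain ⟨x', hx', hxx⟩ := hatt x hx
    obtain ⟨y', hy', hyy⟩ := hatt y hy
    have h1 := hle _ (convex_Icc (0 : ℝ) 1 hx hy ha hb hab) _
      (convex_Icc (0 : ℝ) 1 hx' hy' ha hb hab)
    have h2 := hw.2 hx' hy' ha hb hab
    have h3 : max 0 (a • x + b • y - (a • x' + b • y')) ≤
        a * max 0 (x - x') + b * max 0 (y - y') := by
      have k1 := mul_le_mul_of_nonneg_left (le_max_left 0 (x - x')) ha
      have k2 := mul_le_mul_of_nonneg_left (le_max_right 0 (x - x')) ha
      have k3 := mul_le_mul_of_nonneg_left (le_max_left 0 (y - y')) hb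
      have k4 := mul_le_mul_of_nonneg_left (le_max_right 0 (y - y')) hb
      simp only [smul_eq_mul]
      exact max_le (by linarith) (by linarith)
    have h4 := mul_le_mul_of_nonneg_left hxx ha
    have h5 := mul_le_mul_of_nonneg_left hyy hb
    simp only [smul_eq_mul] at *
    linarith
  monotoneOn := fun x hx y hy h => by
    obtain ⟨y', hy', hyy⟩ := hatt y hy
    have := hle x hx y' hy'
    have : max 0 (x - y') ≤ max 0 (y - y') := max_le_max le_rfl (by linarith)
    linarith
  slope_le := fun x hx y hy h => by
    obtain ⟨x', hx', hxx⟩ := hatt x hx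
    have := hle y hy x' hx'
    have : max 0 (y - x') ≤ max 0 (x - x') + (y - x) :=
      max_le (by linarith [le_max_left 0 (x - x')]) (by linarith [le_max_right 0 (x - x')])
    linarith
  nonneg := fun x hx => by
    obtain ⟨x', hx', hxx⟩ := hatt x hx
    linarith [hw0 x' hx', le_max_left 0 (x - x')]

/-- Here `b` minimizes `w` and `c` minimizes `w - id`. By convexity the slopes of `w` are
nonpositive before `b`, in `[0,1]` between, and at least 1 after `c`, so only the two outer pieces
need flattening. -/
theorem exists_largest_boundaryUtility_le {w : ℝ → ℝ} (hw : ConvexOn ℝ (Icc 0 1) w)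
    (hwc : ContinuousOn w (Icc 0 1)) (hw0 : ∀ x ∈ Icc (0 : ℝ) 1, 0 ≤ w x) :
    ∃ (W : ℝ → ℝ) (b c : ℝ), IsBoundaryUtility W ∧ b ∈ Icc (0 : ℝ) 1 ∧ c ∈ Icc (0 : ℝ) 1 ∧
      (∀ x ∈ Icc (0 : ℝ) 1, W x ≤ w x) ∧ (∀ x ∈ Icc b c, W x = w x) ∧
      (∀ x ∈ Icc 0 b, W x = W 0) ∧ (∀ x ∈ Icc c 1, W x = W 1 + (x - 1)) ∧
      AntitoneOn w (Icc 0 b) ∧ MonotoneOn (fun x => w x - x) (Icc c 1) := by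
  have hI : (Icc (0 : ℝ) 1).Nonempty := ⟨0, by simp⟩
  obtain ⟨b, hb, hbmin⟩ := isCompact_Icc.exists_isMinOn hI hwc
  obtain ⟨c, hc, hcmin⟩ := isCompact_Icc.exists_isMinOn hI (hwc.sub continuousOn_id)
  replace hbmin : ∀ y ∈ Icc (0 : ℝ) 1, w b ≤ w y := fun y hy => hbmin hy
  replace hcmin : ∀ y ∈ Icc (0 : ℝ) 1, w c - c ≤ w y - y := fun y hy => hcmin hy
  have hbc : b ≤ c := by linarith [hbmin c hc, hcmin b hb]
  have hw' : ConvexOn ℝ (Icc 0 1) (fun x => w x - x) := hw.sub (concaveOn_id (convex_Icc 0 1))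
  have hanti : ∀ x y, 0 ≤ x → x ≤ y → y ≤ b → w y ≤ w x := fun x y h0 hxy hyb => by
    have hx : x ∈ Icc (0 : ℝ) 1 := ⟨h0, (hxy.trans hyb).trans hb.2⟩
    have := hw.le_max_of_mem_Icc hx hb ⟨hxy, hyb⟩
    rwa [max_eq_left (hbmin x hx)] at this
  have hmono : ∀ x y, b ≤ x → x ≤ y → y ≤ 1 → w x ≤ w y := fun x y hbx hxy h1 => by
    have hy : y ∈ Icc (0 : ℝ) 1 := ⟨(hb.1.trans hbx).trans hxy, h1⟩
    have := hw.le_max_of_mem_Icc hb hy ⟨hbx, hxy⟩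
    rwa [max_eq_right (hbmin y hy)] at this
  have hanti' : ∀ x y, 0 ≤ x → x ≤ y → y ≤ c → w y - y ≤ w x - x := fun x y h0 hxy hyb => by
    have hx : x ∈ Icc (0 : ℝ) 1 := ⟨h0, (hxy.trans hyb).trans hc.2⟩
    have := hw'.le_max_of_mem_Icc hx hc ⟨hxy, hyb⟩
    rwa [max_eq_left (hcmin x hx)] at this
  have hmono' : ∀ x y, c ≤ x → x ≤ y → y ≤ 1 → w x - x ≤ w y - y := fun x y hbx hxy h1 => by
    have hy : y ∈ Icc (0 : ℝ) 1 := ⟨(hc.1.trans hbx).trans hxy, h1⟩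
    have := hw'.le_max_of_mem_Icc hc hy ⟨hbx, hxy⟩
    rwa [max_eq_right (hcmin y hy)] at this
  set W : ℝ → ℝ := fun x => w (max b (min c x)) + max 0 (x - c) with hWdef
  have hW1 : ∀ x, x ≤ b → W x = w b := fun x hx => by
    simp [hWdef, hx, hx.trans hbc]
  have hW2 : ∀ x ∈ Icc b c, W x = w x := fun x hx => by
    simp [hWdef, hx.1, hx.2]
  have hW3 : ∀ x, c ≤ x → W x = w c + (x - c) := fun x hx => by
    simp [hWdef, hx, hbc]
  have hle : ∀ x ∈ Icc (0 : ℝ) 1, ∀ y ∈ Icc (0 : ℝ) 1, W x ≤ w y + max 0 (x - y) := by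
    intro x hx y hy
    have k1 := le_max_left 0 (x - y)
    have k2 := le_max_right 0 (x - y)
    rcases le_total x b with h | h
    · rw [hW1 x h]
      linarith [hbmin y hy]
    rcases le_total x c with h' | h'
    · rw [hW2 x ⟨h, h'⟩]
      rcases le_total x y with hxy | hxy
      · linarith [hmono x y h hxy hy.2]
      · linarith [hanti' y x hy.1 hxy h']
    · rw [hW3 x h']
      linarith [hcmin y hy]
  have hatt : ∀ x ∈ Icc (0 : ℝ) 1, ∃ y ∈ Icc (0 : ℝ) 1, w y + max 0 (x - y) ≤ W x := by
    intro x hx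
    rcases le_total x b with h | h
    · exact ⟨b, hb, by rw [hW1 x h, max_eq_left (by linarith)]; simp⟩
    rcases le_total x c with h' | h'
    · exact ⟨x, hx, by rw [hW2 x ⟨h, h'⟩]; simp⟩
    · exact ⟨c, hc, by rw [hW3 x h', max_eq_right (by linarith)]⟩
  refine ⟨W, b, c, .of_infConvolution hw hw0 hle hatt, hb, hc, fun x hx => ?_, hW2, fun x hx => ?_,
    fun x hx => ?_, fun x hx y hy h => hanti x y hx.1 h hy.2,
    fun x hx y hy h => hmono' x y hx.1 h hy.2⟩
  · simpa using hle x hx x hx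
  · rw [hW1 x hx.2, hW1 0 hb.1]
  · rw [hW3 x hx.1, hW3 1 hc.2]
    ring

/-! ### Pooling -/

/-- A boundary utility that cannot be moved towards the convex function `w` on `(0,m)` and upwards on
`(m,1)` is flat, then equal to `w`, then of slope one. -/
theorem exists_pooling_structure {U w : ℝ → ℝ} {m : ℝ} (hU : IsBoundaryUtility U)
    (hw : ConvexOn ℝ (Icc 0 1) w) (hwc : ContinuousOn w (Icc 0 1))
    (hw0 : ∀ x ∈ Icc (0 : ℝ) 1, 0 ≤ w x) (hm : m ∈ Ioo (0 : ℝ) 1)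
    (hmax : ∀ V, IsBoundaryUtility V →
      (∀ x ∈ Ioo 0 m, (U x < V x → V x ≤ w x) ∧ (V x < U x → w x ≤ V x)) →
      (∀ x ∈ Ioo m 1, U x ≤ V x) → ∀ x ∈ Icc (0 : ℝ) 1, V x = U x) :
    ∃ b₀ a₁, 0 ≤ b₀ ∧ b₀ ≤ a₁ ∧ a₁ ≤ m ∧ (∀ x ∈ Icc 0 b₀, U x = U 0) ∧
      (∀ x ∈ Ico b₀ a₁, U x = w x) ∧ ∀ x ∈ Icc a₁ 1, U x = U a₁ + (x - a₁) := by
  have hsub : ∀ x ∈ Ioo 0 m, x ∈ Icc (0 : ℝ) 1 := fun x hx => ⟨hx.1.le, (hx.2.trans hm.2).le⟩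
  have hsub' : ∀ x ∈ Ioo m 1, x ∈ Icc (0 : ℝ) 1 := fun x hx => ⟨(hm.1.trans hx.1).le, hx.2.le⟩
  have h0 : (0 : ℝ) ∈ Icc (0 : ℝ) 1 := by simp
  have h1 : (1 : ℝ) ∈ Icc (0 : ℝ) 1 := by simp
  have hmI : m ∈ Icc (0 : ℝ) 1 := Ioo_subset_Icc_self hm
  -- moving upwards only
  have hup : ∀ V, IsBoundaryUtility V → (∀ x ∈ Icc (0 : ℝ) 1, U x ≤ V x) →
      (∀ x ∈ Ioo 0 m, U x < V x → V x ≤ w x) → ∀ x ∈ Icc (0 : ℝ) 1, V x = U x :=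
    fun V hV hle h => hmax V hV (fun x hx => ⟨h x hx, fun hlt =>
      absurd (hle x (hsub x hx)) (not_le.2 hlt)⟩) (fun x hx => hle x (hsub' x hx))
  -- Raising `U` to the constant `τ` is an admissible upward move, so it changes nothing. The next
  -- claim does the same with a line of slope one.
  have hupA : ∀ τ, (∀ x ∈ Ioo 0 m, U x < τ → τ ≤ w x) → τ ≤ U 0 := fun τ h => by
    have := hup _ (hU.sup_affine h0 τ) (fun x _ => le_max_left _ _) (fun x hx hlt => by
      have hlt' : U x < τ := by simpa using hlt
      simpa [hlt'.le] using h x hx hlt') 0 h0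
    simpa using this
  have hupB : ∀ τ, (∀ x ∈ Ioo 0 m, U x < x + τ → x + τ ≤ w x) → ∀ x ∈ Icc (0 : ℝ) 1,
      x + τ ≤ U x := fun τ h x hx => by
    have := hup _ (hU.sup_affine h1 τ) (fun x _ => le_max_left _ _) (fun x hx hlt => by
      have hlt' : U x < x + τ := by simpa using hlt
      simpa [hlt'.le] using h x hx hlt') x hx
    simpa using this
  -- The line of slope one through `(m, U m)` lies below `U` to the left of `m`, so raising `U` to
  -- it is only a move on `(m,1)`. Hence `U` already has slope one beyond `m`.
  have hmtop : ∀ x ∈ Icc (0 : ℝ) 1, x + (U m - m) ≤ U x := hupB _ fun x hx hlt => by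
    linarith [hU.slope_le x (hsub x hx) m hmI hx.2.le]
  have hmB : U m - m = U 1 - 1 := by
    linarith [hmtop 1 h1, hU.slope_le m hmI 1 h1 hm.2.le]
  set A := U 0 with hA
  set B := U 1 - 1 with hB
  have hUA : ∀ x ∈ Icc (0 : ℝ) 1, A ≤ U x := fun x hx => hU.monotoneOn h0 hx hx.1
  have hUB : ∀ x ∈ Icc (0 : ℝ) 1, x + B ≤ U x := fun x hx => by
    linarith [hU.slope_le x hx 1 h1 hx.2]
  obtain ⟨W, b, c, hW, hb, hc, hWw, hWmid, hWb, hWc, hanti, hmono⟩ :=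
    exists_largest_boundaryUtility_le hw hwc hw0
  have hWU : ∀ x ∈ Icc (0 : ℝ) 1, W x ≤ U x := fun x hx => by
    have := hup _ (hU.sup hW) (fun x _ => le_max_left _ _) (fun x hx hlt => by
      have hlt' : U x < W x := by simpa using hlt
      simpa [hlt'.le] using hWw x (hsub x hx)) x hx
    simpa using this
  -- The smallest candidate known to lie below `U`. The aim is to show that lowering `U` to `V` is
  -- an admissible move, hence trivial.
  set V : ℝ → ℝ := fun x => max (max (W x) (0 * x + A)) (1 * x + B) with hVdef
  have hV : IsBoundaryUtility V := (hW.sup_affine h0 A).sup_affine h1 B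
  have hVW : ∀ x, W x ≤ V x := fun x => (le_max_left _ _).trans (le_max_left _ _)
  have hVA : ∀ x, A ≤ V x := fun x => by
    have : 0 * x + A ≤ V x := (le_max_right _ _).trans (le_max_left _ _)
    linarith
  have hVB : ∀ x, x + B ≤ V x := fun x => by
    have : 1 * x + B ≤ V x := le_max_right _ _
    linarith
  have hVU : ∀ x ∈ Icc (0 : ℝ) 1, V x ≤ U x := fun x hx =>
    max_le (max_le (hWU x hx) (by linarith [hUA x hx])) (by linarith [hUB x hx])
  have hkey : ∀ x ∈ Icc (0 : ℝ) 1, V x = U x := by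
    refine hmax V hV (fun x hx => ⟨fun hlt => absurd (hVU x (hsub x hx)) (not_le.2 hlt),
      fun hlt => ?_⟩) (fun x hx => ?_)
    · have hxI := hsub x hx
      by_contra! hxw
      rcases lt_or_ge x b with hxb | hxb
      -- If both `U` and `w` exceed `V` at `x < b`, a constant slightly above `A` is still an
      -- admissible raise: `U` lies below it only to the left of `x`, where `w ≥ w x`. The case `c <
      -- x` is the analogue with slope one.
      · have hτ : A < min (U x) (w x) :=
          lt_min ((hVA x).trans_lt hlt) ((hVA x).trans_lt hxw)
        refine absurd (hupA _ fun y hy hyτ => ?_) (not_le.2 hτ)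
        have hyx : y < x := by
          by_contra! h
          exact absurd (hU.monotoneOn hxI (hsub y hy) h)
            (not_le.2 (hyτ.trans_le (min_le_left _ _)))
        exact (min_le_right _ _).trans (hanti ⟨hy.1.le, (hyx.trans hxb).le⟩ ⟨hxI.1, hxb.le⟩ hyx.le)
      rcases lt_or_ge c x with hxc | hxc
      · have hτ : B < min (U x - x) (w x - x) :=
          lt_min (by linarith [hVB x]) (by linarith [hVB x])
        have := hupB (min (U x - x) (w x - x)) (fun y hy hyτ => ?_) 1 h1
        · linarith
        have hyx : x < y := by
          by_contra! h
          linarith [hU.slope_le y (hsub y hy) x hxI h, min_le_left (U x - x) (w x - x)]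
        have := hmono ⟨hxc.le, hxI.2⟩ ⟨(hxc.trans hyx).le, (hsub y hy).2⟩ hyx.le
        simp only at this
        linarith [min_le_right (U x - x) (w x - x)]
      · linarith [hWmid x ⟨hxb, hxc⟩, hVW x]
    · linarith [hVB x, hU.slope_le m hmI x (hsub' x hx) hx.1.le]
  have hUc := hU.continuousOn
  have hSA : IsCompact {x ∈ Icc (0 : ℝ) 1 | U x ≤ A} :=
    (isCompact_Icc.of_isClosed_subset
      (hUc.preimage_isClosed_of_isClosed isClosed_Icc isClosed_Iic) (fun x hx => hx.1))
  have hSB : IsCompact {x ∈ Icc (0 : ℝ) 1 | U x - x ≤ B} :=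
    (isCompact_Icc.of_isClosed_subset
      ((hUc.sub continuousOn_id).preimage_isClosed_of_isClosed isClosed_Icc isClosed_Iic)
      (fun x hx => hx.1))
  have hmB' : m ∈ {x ∈ Icc (0 : ℝ) 1 | U x - x ≤ B} := ⟨hmI, hmB.le⟩
  have hb₀ := hSA.sSup_mem ⟨0, h0, le_rfl⟩
  have ha₁ := hSB.sInf_mem ⟨m, hmB'⟩
  have hb₀max : ∀ x ∈ Icc (0 : ℝ) 1, U x ≤ A → x ≤ sSup {x ∈ Icc (0 : ℝ) 1 | U x ≤ A} :=
    fun x hx h => le_csSup hSA.bddAbove ⟨hx, h⟩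
  have ha₁min : ∀ x ∈ Icc (0 : ℝ) 1, U x - x ≤ B → sInf {x ∈ Icc (0 : ℝ) 1 | U x - x ≤ B} ≤ x :=
    fun x hx h => csInf_le hSB.bddBelow ⟨hx, h⟩
  generalize sSup {x ∈ Icc (0 : ℝ) 1 | U x ≤ A} = b₀ at hb₀ hb₀max
  generalize sInf {x ∈ Icc (0 : ℝ) 1 | U x - x ≤ B} = a₁ at ha₁ ha₁min
  obtain ⟨hb₀I, hb₀A⟩ := hb₀
  obtain ⟨ha₁I, ha₁B⟩ := ha₁
  have hle : b₀ ≤ a₁ := by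
    by_contra! h
    linarith [hUA a₁ ha₁I, hUB b₀ hb₀I, hU.slope_le a₁ ha₁I b₀ hb₀I h.le]
  refine ⟨b₀, a₁, hb₀I.1, hle, ha₁min m hmI hmB.le, fun x hx => ?_, fun x hx => ?_, fun x hx => ?_⟩
  · have hxI : x ∈ Icc (0 : ℝ) 1 := ⟨hx.1, hx.2.trans hb₀I.2⟩
    exact le_antisymm ((hU.monotoneOn hxI hb₀I hx.2).trans hb₀A) (hUA x hxI)
  · have hsubI : Icc b₀ a₁ ⊆ Icc (0 : ℝ) 1 := Icc_subset_Icc hb₀I.1 ha₁I.2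
    have heq : EqOn U w (Ioo b₀ a₁) := by
      intro x hx
      have hxI := hsubI (Ioo_subset_Icc_self hx)
      have hxA : A < U x := by
        by_contra! h
        exact absurd (hb₀max x hxI h) (not_le.2 hx.1)
      have hxB : x + B < U x := by
        by_contra! h
        exact absurd (ha₁min x hxI (by linarith)) (not_le.2 hx.2)
      have hxW : U x ≤ W x := by
        rw [← hkey x hxI] at hxA hxB ⊢
        by_contra! h
        have : V x < V x := max_lt (max_lt h (by linarith)) (by linarith)
        exact lt_irrefl _ this
      have hxb : b ≤ x := by
        by_contra! h
        linarith [hWb x ⟨hxI.1, h.le⟩, hWU 0 h0]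
      have hxc : x ≤ c := by
        by_contra! h
        linarith [hWc x ⟨h.le, hxI.2⟩, hWU 1 h1]
      exact (le_antisymm hxW (hWU x hxI)).trans (hWmid x ⟨hxb, hxc⟩)
    have hlt : b₀ < a₁ := hx.1.trans_lt hx.2
    -- Equality at the left endpoint `b₀` follows by continuity from the open interval.
    exact heq.of_subset_closure (hUc.mono hsubI) (hwc.mono hsubI) Ioo_subset_Icc_self
      (closure_Ioo hlt.ne).ge ⟨hx.1, hx.2.le⟩
  · have hxI : x ∈ Icc (0 : ℝ) 1 := ⟨ha₁I.1.trans hx.1, hx.2⟩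
    linarith [hU.slope_le a₁ ha₁I x hxI hx.1, hUB x hxI]

/-! ### The threshold function -/

/-- The integral condition defining the threshold function. -/
noncomputable def excess (f : ℝ × ℝ → ℝ) (x z : ℝ) : ℝ :=
  (∫ t in z..1, extendSquare (mrDensity f) (x, t)) - extendSquare f (x, 1)

/-- A continuous function that is positive almost everywhere is nonnegative everywhere, because the
square is the closure of its interior. -/
theorem mrDensity_nonneg {f : ℝ × ℝ → ℝ} (hf : IsTypeDensity f) (hs : IsSRS f) :
    ∀ x ∈ square, 0 ≤ mrDensity f x := by
  have h : mrDensity f =ᵐ[volume.restrict square] fun x => max 0 (mrDensity f x) := by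
    filter_upwards [hs.regular] with x hx
    rw [max_eq_right hx.le]
  have hint : square ⊆ closure (interior square) := by
    rw [square, interior_prod_eq, closure_prod_eq, interior_Icc, closure_Ioo zero_ne_one]
  intro x hx
  rw [Measure.eqOn_of_ae_eq h hf.continuousOn_mrDensity
    (continuousOn_const.sup hf.continuousOn_mrDensity) hint hx]
  exact le_max_left _ _

theorem extendSquare_mrDensity_nonneg {f : ℝ × ℝ → ℝ} (hf : IsTypeDensity f) (hs : IsSRS f)
    (x : ℝ × ℝ) : 0 ≤ extendSquare (mrDensity f) x :=
  mrDensity_nonneg hf hs _ (clamp_mem_square x)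

theorem continuous_excess {X : Type*} [TopologicalSpace X] {f : ℝ × ℝ → ℝ}
    (hf : IsTypeDensity f) {a b : X → ℝ} (ha : Continuous a) (hb : Continuous b) :
    Continuous fun x => excess f (a x) (b x) := by
  have hF := continuous_extendSquare hf.continuousOn
  have hΦ := continuous_extendSquare hf.continuousOn_mrDensity
  have h : Continuous fun x => ∫ t in (1 : ℝ)..b x, extendSquare (mrDensity f) (a x, t) :=
    intervalIntegral.continuous_parametric_intervalIntegral_of_continuous
      (f := fun x t => extendSquare (mrDensity f) (a x, t))
      (by simp only [Function.uncurry_def]; fun_prop) hb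
  simp only [excess, intervalIntegral.integral_symm 1]
  fun_prop

theorem excess_sub_excess {f : ℝ × ℝ → ℝ} (hf : IsTypeDensity f) (x y z : ℝ) :
    excess f x y - excess f x z = ∫ t in y..z, extendSquare (mrDensity f) (x, t) := by
  have hΦ := continuous_extendSquare hf.continuousOn_mrDensity
  have hi : ∀ a b, IntervalIntegrable (fun t => extendSquare (mrDensity f) (x, t)) volume a b :=
    fun a b => Continuous.intervalIntegrable (by fun_prop) a b
  have := intervalIntegral.integral_add_adjacent_intervals (hi y z) (hi z 1)
  simp only [excess]
  linarith

theorem excess_antitone {f : ℝ × ℝ → ℝ} (hf : IsTypeDensity f) (hs : IsSRS f) (x : ℝ) {y z : ℝ}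
    (h : y ≤ z) : excess f x z ≤ excess f x y := by
  have := intervalIntegral.integral_nonneg (μ := volume) h
    fun t _ => extendSquare_mrDensity_nonneg hf hs (x, t)
  linarith [excess_sub_excess hf x y z]

/-- By Fubini, on almost every vertical line `φ` is positive almost everywhere, so its integral over
any nondegenerate interval is positive. -/
theorem ae_excess_strictAntiOn {f : ℝ × ℝ → ℝ} (hf : IsTypeDensity f) (hs : IsSRS f) :
    ∀ᵐ x ∂volume.restrict (Icc (0 : ℝ) 1), StrictAntiOn (excess f x) (Icc 0 1) := by
  have hr := hs.regular
  rw [square, Measure.volume_eq_prod, ← Measure.prod_restrict] at hr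
  filter_upwards [Measure.ae_ae_of_ae_prod hr, ae_restrict_mem measurableSet_Icc] with x hx hxI
  intro y hy z hz hyz
  have hΦ := continuous_extendSquare hf.continuousOn_mrDensity
  have hsub : Ioo y z ⊆ Icc (0 : ℝ) 1 := fun t ht => ⟨hy.1.trans ht.1.le, ht.2.le.trans hz.2⟩
  have : (ae (volume.restrict (Ioo y z))).NeBot := by
    rw [ae_restrict_neBot]
    simpa using hyz
  obtain ⟨t, ht, htI⟩ := ((ae_restrict_of_ae_restrict_of_subset hsub hx).and
    (ae_restrict_mem measurableSet_Ioo)).exists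
  have hpos := intervalIntegral.integral_pos (f := fun t => extendSquare (mrDensity f) (x, t)) hyz
    (Continuous.continuousOn (by fun_prop))
    (fun t _ => extendSquare_mrDensity_nonneg hf hs (x, t))
    ⟨t, Ioo_subset_Icc_self htI, by rwa [extendSquare_eq ⟨hxI, hsub htI⟩]⟩
  linarith [excess_sub_excess hf x y z]

theorem zeta_eq {f : ℝ × ℝ → ℝ} {x : ℝ} (hx : x ∈ Icc (0 : ℝ) 1) :
    zeta f x = sSup {z ∈ Icc (0 : ℝ) 1 | 0 ≤ excess f x z} := by
  unfold zeta
  congr 1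
  ext z
  refine and_congr_right fun hz => ?_
  have h1 : ∫ t in z..1, extendSquare (mrDensity f) (x, t) = ∫ t in z..1, mrDensity f (x, t) := by
    refine intervalIntegral.integral_congr fun t ht => ?_
    rw [uIcc_of_le hz.2] at ht
    exact extendSquare_eq ⟨hx, hz.1.trans ht.1, ht.2⟩
  rw [excess, h1, extendSquare_eq (x := (x, 1)) ⟨hx, by simp⟩]

theorem zeta_mem_Icc (f : ℝ × ℝ → ℝ) (x : ℝ) : zeta f x ∈ Icc (0 : ℝ) 1 :=
  ⟨Real.sSup_nonneg fun _ hz => hz.1.1, Real.sSup_le (fun _ hz => hz.1.2) zero_le_one⟩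

theorem excess_neg_of_zeta_lt {f : ℝ × ℝ → ℝ} {x z : ℝ} (hx : x ∈ Icc (0 : ℝ) 1)
    (hz : zeta f x < z) (hz1 : z ≤ 1) : excess f x z < 0 := by
  by_contra! h
  rw [zeta_eq hx] at hz
  have hz0 : 0 ≤ z := (Real.sSup_nonneg fun _ hz => hz.1.1).trans hz.le
  exact absurd (le_csSup ⟨1, fun _ hz => hz.1.2⟩ (show z ∈ {z ∈ Icc (0 : ℝ) 1 | 0 ≤ excess f x z}
    from ⟨⟨hz0, hz1⟩, h⟩)) (not_le.2 hz)

theorem excess_nonpos_of_zeta_le {f : ℝ × ℝ → ℝ} (hf : IsTypeDensity f) {x z : ℝ}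
    (hx : x ∈ Icc (0 : ℝ) 1) (hz : zeta f x ≤ z) (hz1 : z ≤ 1) : excess f x z ≤ 0 := by
  have hc : Continuous fun z => excess f x z :=
    continuous_excess hf continuous_const continuous_id
  rcases hz1.eq_or_lt with rfl | hz1
  · simp only [excess, intervalIntegral.integral_same]
    linarith [hf.nonneg _ (clamp_mem_square (x, 1)), show extendSquare f (x, 1) = f _ from rfl]
  · have : closure (Ioo z 1) ⊆ {y | excess f x y ≤ 0} :=
      closure_minimal (fun y hy => (excess_neg_of_zeta_lt hx (hz.trans_lt hy.1) hy.2.le).le)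
        (isClosed_le hc continuous_const)
    rw [closure_Ioo hz1.ne] at this
    exact this ⟨le_rfl, hz1.le⟩

/-- The supremum is attained by compactness. Positivity of `ζ` excludes the convention `sup ∅ = 0`,
for which the inequality may fail. -/
theorem excess_zeta_nonneg {f : ℝ × ℝ → ℝ} (hf : IsTypeDensity f) {x : ℝ}
    (hx : x ∈ Icc (0 : ℝ) 1) (h : 0 < zeta f x) : 0 ≤ excess f x (zeta f x) := by
  have hc : Continuous fun z => excess f x z :=
    continuous_excess hf continuous_const continuous_id
  have hcomp : IsCompact {z ∈ Icc (0 : ℝ) 1 | 0 ≤ excess f x z} :=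
    isCompact_Icc.inter_right (isClosed_le continuous_const hc)
  rw [zeta_eq hx] at h ⊢
  refine (hcomp.sSup_mem ?_).2
  by_contra! hne
  rw [hne, Real.sSup_empty] at h
  exact lt_irrefl _ h

theorem excess_nonneg_of_le_zeta {f : ℝ × ℝ → ℝ} (hf : IsTypeDensity f) (hs : IsSRS f) {x z : ℝ}
    (hx : x ∈ Icc (0 : ℝ) 1) (h : 0 < zeta f x) (hz : z ≤ zeta f x) : 0 ≤ excess f x z :=
  (excess_zeta_nonneg hf hx h).trans (excess_antitone hf hs x hz)

/-- Upper semicontinuity: a negative excess at a level `d` strictly between `ζ(x)` and `c` persists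
for nearby `y`. -/
theorem eventually_zeta_lt {f : ℝ × ℝ → ℝ} (hf : IsTypeDensity f) (hs : IsSRS f) {x c : ℝ}
    (hx : x ∈ Icc (0 : ℝ) 1) (hc : zeta f x < c) :
    ∀ᶠ y in nhdsWithin x (Icc 0 1), zeta f y < c := by
  obtain ⟨d, hd, hdc⟩ := exists_between hc
  rcases lt_or_ge 1 d with h1 | h1
  · exact .of_forall fun y => (zeta_mem_Icc f y).2.trans_lt (h1.trans hdc)
  · have hcont : Continuous fun y => excess f y d :=
      continuous_excess hf continuous_id continuous_const
    have hev : ∀ᶠ y in nhds x, excess f y d < 0 :=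
      hcont.continuousAt.eventually_lt continuousAt_const (excess_neg_of_zeta_lt hx hd h1)
    filter_upwards [nhdsWithin_le_nhds hev, self_mem_nhdsWithin] with y hy hyI
    refine lt_of_le_of_lt ?_ hdc
    by_contra! h
    have hd0 : 0 ≤ d := (zeta_mem_Icc f x).1.trans hd.le
    exact absurd (excess_nonneg_of_le_zeta hf hs hyI (hd0.trans_lt h) h.le) (not_le.2 hy)

/-- Compare `g` with its chord from `x` to the endpoint of `[0,1]` on the side of `y`, dropping the
nonnegative value there. At `x = 0` or `x = 1` the term that is zero by convention belongs to the
side on which no `y` lies. This gives lower semicontinuity up to the endpoints. -/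
theorem sub_mul_abs_le_of_concaveOn {g : ℝ → ℝ} (hg : ConcaveOn ℝ (Icc 0 1) g)
    (h0 : ∀ x ∈ Icc (0 : ℝ) 1, 0 ≤ g x) {x y : ℝ} (hx : x ∈ Icc (0 : ℝ) 1)
    (hy : y ∈ Icc (0 : ℝ) 1) : g x - g x * (1 / (1 - x) + 1 / x) * |y - x| ≤ g y := by
  have hx1 : 0 ≤ 1 / (1 - x) := one_div_nonneg.2 (sub_nonneg.2 hx.2)
  have hx0 : 0 ≤ 1 / x := one_div_nonneg.2 hx.1
  have hgx := h0 x hx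
  rcases lt_trichotomy x y with h | rfl | h
  · have hpos : 0 < 1 - x := by linarith [hy.2]
    have := hg.2 hx (show (1 : ℝ) ∈ Icc (0 : ℝ) 1 by simp)
      (div_nonneg (by linarith [hy.2]) hpos.le : 0 ≤ (1 - y) / (1 - x))
      (div_nonneg (by linarith) hpos.le : 0 ≤ (y - x) / (1 - x)) (by field_simp; ring)
    have e : ((1 - y) / (1 - x)) • x + ((y - x) / (1 - x)) • (1 : ℝ) = y := by
      simp only [smul_eq_mul]
      field_simp
      ring
    rw [e] at this
    have e1 : (1 - y) / (1 - x) = 1 - 1 / (1 - x) * (y - x) := by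
      field_simp
      ring
    rw [e1] at this
    simp only [smul_eq_mul] at this
    have h2 : 0 ≤ (y - x) / (1 - x) * g 1 :=
      mul_nonneg (div_nonneg (by linarith) hpos.le) (h0 1 (by simp))
    have h3 : 0 ≤ g x * (1 / x) * (y - x) :=
      mul_nonneg (mul_nonneg hgx hx0) (by linarith)
    rw [abs_of_pos (sub_pos.2 h)]
    linarith
  · simp
  · have hpos : 0 < x := hy.1.trans_lt h
    have := hg.2 hx (show (0 : ℝ) ∈ Icc (0 : ℝ) 1 by simp)
      (div_nonneg hy.1 hpos.le : 0 ≤ y / x)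
      (div_nonneg (by linarith) hpos.le : 0 ≤ (x - y) / x) (by field_simp; ring)
    have e : (y / x) • x + ((x - y) / x) • (0 : ℝ) = y := by
      simp only [smul_eq_mul]
      field_simp
      ring
    rw [e] at this
    have e1 : y / x = 1 - 1 / x * (x - y) := by
      field_simp
      ring
    rw [e1] at this
    simp only [smul_eq_mul] at this
    have h2 : 0 ≤ (x - y) / x * g 0 :=
      mul_nonneg (div_nonneg (by linarith) hpos.le) (h0 0 (by simp))
    have h3 : 0 ≤ g x * (1 / (1 - x)) * (x - y) :=
      mul_nonneg (mul_nonneg hgx hx1) (by linarith)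
    rw [abs_of_neg (sub_neg.2 h)]
    linarith

theorem continuousOn_zeta {f : ℝ × ℝ → ℝ} (hf : IsTypeDensity f) (hs : IsSRS f)
    (hζ : ConcaveOn ℝ (Icc 0 1) (zeta f)) : ContinuousOn (zeta f) (Icc 0 1) := by
  intro x hx
  refine tendsto_order.2 ⟨fun c hc => ?_, fun c hc => eventually_zeta_lt hf hs hx hc⟩
  have hcont : Continuous fun y =>
      zeta f x - zeta f x * (1 / (1 - x) + 1 / x) * |y - x| := by fun_prop
  have hev : ∀ᶠ y in nhds x, c < zeta f x - zeta f x * (1 / (1 - x) + 1 / x) * |y - x| :=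
    continuousAt_const.eventually_lt hcont.continuousAt (by simpa using hc)
  filter_upwards [nhdsWithin_le_nhds hev, self_mem_nhdsWithin] with y hy hyI
  exact hy.trans_le (sub_mul_abs_le_of_concaveOn hζ (fun x _ => (zeta_mem_Icc f x).1) hx hyI)

/-! ### Monotonicity of the profit -/

theorem setIntegral_extendSquare_eq_excess {f : ℝ × ℝ → ℝ} {x z : ℝ} (hz : z ≤ 1) :
    ∫ t in Ioo z 1, extendSquare (mrDensity f) (x, t) = excess f x z + extendSquare f (x, 1) := by
  rw [excess, intervalIntegral.integral_of_le hz, integral_Ioc_eq_integral_Ioo]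
  ring

theorem profit_eq {f : ℝ × ℝ → ℝ} {s : ℝ} (hs : s ∈ Ioo (0 : ℝ) 1) (v : ℝ) :
    profit f s v = v * extendSquare f (s, 1) -
      ∫ t in Ioo s 1, max 0 (v + t - 1) * extendSquare (mrDensity f) (s, t) := by
  rw [profit, extendSquare_eq (x := (s, 1)) ⟨Ioo_subset_Icc_self hs, by simp⟩]
  congr 1
  refine setIntegral_congr_fun measurableSet_Ioo fun t ht => ?_
  simp only [extendSquare_eq (g := mrDensity f) (x := (s, t))
    ⟨Ioo_subset_Icc_self hs, (hs.1.trans ht.1).le, ht.2.le⟩]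

/-- The increment of the profit, compared with the increment it would have if the types that
matter were those in `(z, 1)`. -/
theorem profit_sub_profit_add {f : ℝ × ℝ → ℝ} (hf : IsTypeDensity f) {s z : ℝ}
    (hs : s ∈ Ioo (0 : ℝ) 1) (hsz : s ≤ z) (hz : z ≤ 1) (v v' : ℝ) :
    profit f s v' - profit f s v + (v' - v) * excess f s z = ∫ t in Ioo s 1,
      ((Ioo z 1).indicator (fun _ => v' - v) t - (max 0 (v' + t - 1) - max 0 (v + t - 1))) *
        extendSquare (mrDensity f) (s, t) := by
  have hΦ := continuous_extendSquare hf.continuousOn_mrDensity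
  have hi : ∀ v : ℝ, IntegrableOn
      (fun t => max 0 (v + t - 1) * extendSquare (mrDensity f) (s, t)) (Ioo s 1) := fun v =>
    ((Continuous.continuousOn (by fun_prop)).integrableOn_compact isCompact_Icc).mono_set
      Ioo_subset_Icc_self
  have hi' : IntegrableOn (fun t => (v' - v) * extendSquare (mrDensity f) (s, t)) (Ioo s 1) :=
    ((Continuous.continuousOn (by fun_prop)).integrableOn_compact isCompact_Icc).mono_set
      Ioo_subset_Icc_self
  have h1 : ∫ t in Ioo s 1, (Ioo z 1).indicator
      (fun t => (v' - v) * extendSquare (mrDensity f) (s, t)) t =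
      (v' - v) * (excess f s z + extendSquare f (s, 1)) := by
    rw [setIntegral_indicator measurableSet_Ioo, inter_eq_right.2 (Ioo_subset_Ioo_left hsz),
      integral_const_mul, setIntegral_extendSquare_eq_excess hz]
  have h2 : ∀ t, ((Ioo z 1).indicator (fun _ => v' - v) t -
      (max 0 (v' + t - 1) - max 0 (v + t - 1))) * extendSquare (mrDensity f) (s, t) =
      (Ioo z 1).indicator (fun t => (v' - v) * extendSquare (mrDensity f) (s, t)) t -
      (max 0 (v' + t - 1) * extendSquare (mrDensity f) (s, t) -
        max 0 (v + t - 1) * extendSquare (mrDensity f) (s, t)) := fun t => by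
    by_cases ht : t ∈ Ioo z 1
    · simp only [indicator_of_mem ht]
      ring
    · simp only [indicator_of_notMem ht]
      ring
  simp_rw [h2]
  have h3 := integral_sub (hi'.indicator (measurableSet_Ioo (a := z) (b := 1)))
    ((hi v').sub (hi v))
  simp only [Pi.sub_apply] at h3
  rw [h3, h1, integral_sub (hi v') (hi v), profit_eq hs, profit_eq hs]
  ring

/-- Between `v` and `v'` the marginal profit is at least its value at `v'`, by concavity in `v`:
types below `1 - v'` gain nothing, and those above gain at most `v' - v`. The companion bound uses
the marginal profit at `v`. -/
theorem le_profit_sub_profit {f : ℝ × ℝ → ℝ} (hf : IsTypeDensity f) (hS : IsSRS f) {s v v' : ℝ}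
    (hs : s ∈ Ioo (0 : ℝ) 1) (hv' : 0 ≤ v') (h : v ≤ v') :
    -(v' - v) * excess f s (max s (1 - v')) ≤ profit f s v' - profit f s v := by
  have key := profit_sub_profit_add hf hs (le_max_left s (1 - v'))
    (max_le hs.2.le (by linarith)) v v'
  have : 0 ≤ profit f s v' - profit f s v + (v' - v) * excess f s (max s (1 - v')) := by
    rw [key]
    refine setIntegral_nonneg measurableSet_Ioo fun t ht => ?_
    refine mul_nonneg ?_ (extendSquare_mrDensity_nonneg hf hS _)
    by_cases htz : t ∈ Ioo (max s (1 - v')) 1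
    · rw [indicator_of_mem htz]
      have : 1 - v' < t := (le_max_right _ _).trans_lt htz.1
      rw [max_eq_right (show 0 ≤ v' + t - 1 by linarith)]
      linarith [le_max_right 0 (v + t - 1)]
    · rw [indicator_of_notMem htz]
      have : t ≤ 1 - v' := by
        by_contra! h'
        exact htz ⟨max_lt ht.1 h', ht.2⟩
      rw [max_eq_left (show v' + t - 1 ≤ 0 by linarith), max_eq_left (by linarith)]
      simp
  linarith

theorem profit_sub_profit_le {f : ℝ × ℝ → ℝ} (hf : IsTypeDensity f) (hS : IsSRS f) {s v v' : ℝ}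
    (hs : s ∈ Ioo (0 : ℝ) 1) (hv : 0 ≤ v) (h : v ≤ v') :
    profit f s v' - profit f s v ≤ -(v' - v) * excess f s (max s (1 - v)) := by
  have key := profit_sub_profit_add hf hs (le_max_left s (1 - v))
    (max_le hs.2.le (by linarith)) v v'
  have : profit f s v' - profit f s v + (v' - v) * excess f s (max s (1 - v)) ≤ 0 := by
    rw [key]
    refine setIntegral_nonpos measurableSet_Ioo fun t ht => ?_
    refine mul_nonpos_of_nonpos_of_nonneg ?_ (extendSquare_mrDensity_nonneg hf hS _)
    by_cases htz : t ∈ Ioo (max s (1 - v)) 1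
    · rw [indicator_of_mem htz]
      have : 1 - v < t := (le_max_right _ _).trans_lt htz.1
      rw [max_eq_right (show 0 ≤ v' + t - 1 by linarith),
        max_eq_right (show 0 ≤ v + t - 1 by linarith)]
      linarith
    · rw [indicator_of_notMem htz]
      have : max 0 (v + t - 1) ≤ max 0 (v' + t - 1) := max_le_max le_rfl (by linarith)
      linarith
  linarith

/-- The marginal profit may vanish at `v'` itself, so the interval is split at its midpoint: the
gain is strict on the lower half and nonnegative on the upper. -/
theorem profit_lt_of_lt {f : ℝ × ℝ → ℝ} (hf : IsTypeDensity f) (hS : IsSRS f) {s v v' : ℝ}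
    (hs : s ∈ Ioo (0 : ℝ) 1) (hv : 0 ≤ v) (h : v < v') (hv' : v' ≤ 1 - zeta f s ∨ zeta f s < s) :
    profit f s v < profit f s v' := by
  have hsI := Ioo_subset_Icc_self hs
  have h1 := le_profit_sub_profit hf hS (v := v) (v' := (v + v') / 2) hs (by linarith) (by linarith)
  have h2 := le_profit_sub_profit hf hS (v := (v + v') / 2) (v' := v') hs (by linarith)
    (by linarith)
  have e1 : excess f s (max s (1 - (v + v') / 2)) < 0 := by
    refine excess_neg_of_zeta_lt hsI ?_ (max_le hs.2.le (by linarith))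
    rcases hv' with h' | h'
    · exact lt_max_of_lt_right (by linarith)
    · exact lt_max_of_lt_left h'
  have e2 : excess f s (max s (1 - v')) ≤ 0 := by
    refine excess_nonpos_of_zeta_le hf hsI ?_ (max_le hs.2.le (by linarith))
    rcases hv' with h' | h'
    · exact le_max_of_le_right (by linarith)
    · exact le_max_of_le_left h'.le
  nlinarith

/-- Below `ζ(s)` the excess could remain zero, so strictness needs its strict monotonicity,
available for almost every `s`. -/
theorem profit_lt_of_gt {f : ℝ × ℝ → ℝ} (hf : IsTypeDensity f) (hS : IsSRS f) {s v v' : ℝ}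
    (hs : s ∈ Ioo (0 : ℝ) 1) (hanti : StrictAntiOn (excess f s) (Icc 0 1)) (h : v' < v)
    (hv' : 1 - zeta f s ≤ v') (hsζ : s < zeta f s) : profit f s v < profit f s v' := by
  have hsI := Ioo_subset_Icc_self hs
  have hζ0 : 0 < zeta f s := hs.1.trans hsζ
  have hζI := zeta_mem_Icc f s
  have h1 := profit_sub_profit_le hf hS (v := v') (v' := (v + v') / 2) hs (by linarith [hζI.2])
    (by linarith)
  have h2 := profit_sub_profit_le hf hS (v := (v + v') / 2) (v' := v) hs (by linarith [hζI.2])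
    (by linarith)
  have e1 : 0 ≤ excess f s (max s (1 - v')) :=
    excess_nonneg_of_le_zeta hf hS hsI hζ0 (max_le hsζ.le (by linarith))
  have e2 : 0 < excess f s (max s (1 - (v + v') / 2)) := by
    have hlt : max s (1 - (v + v') / 2) < zeta f s := max_lt hsζ (by linarith)
    exact (excess_zeta_nonneg hf hsI hζ0).trans_lt
      (hanti ⟨hs.1.le.trans (le_max_left _ _), hlt.le.trans hζI.2⟩ hζI hlt)
  nlinarith

/-! ### Where the threshold function crosses the diagonal -/

/-- When `u` depends on `x₁` alone, the vertical integral of `φ` over `(s,1)` combines with the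
boundary term into the excess on the diagonal. -/
theorem integral_triangle_revenue_fst {f : ℝ × ℝ → ℝ} (hf : IsTypeDensity f) {G : ℝ → ℝ}
    {K : NNReal} (hG : LipschitzWith K G) :
    ∫ x in triangle, (fderiv ℝ (fun x : ℝ × ℝ => G x.1) x x - G x.1) * f x =
      ∫ s in Ioo (0 : ℝ) 1, -(G s * excess f s s) := by
  have hF := continuous_extendSquare hf.continuousOn
  have hGc := hG.continuous
  have hu : LipschitzWith K fun x : ℝ × ℝ => G x.1 := by
    have h := hG.comp (LipschitzWith.prod_fst (α := ℝ) (β := ℝ))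
    rw [mul_one] at h
    exact h
  rw [integral_triangle_revenue hf hu]
  have hint : IntegrableOn (fun x : ℝ × ℝ => G x.1 * mrDensity f x) triangle :=
    ((Continuous.continuousOn (by fun_prop)).mul
      hf.continuousOn_mrDensity).integrableOn_compact isCompact_square |>.mono_set
        triangle_subset_square
  have h1 : ∫ x in triangle, G x.1 * mrDensity f x =
      ∫ s in Ioo (0 : ℝ) 1, G s * (excess f s s + extendSquare f (s, 1)) := by
    rw [integral_triangle_vertical hint]
    refine setIntegral_congr_fun measurableSet_Ioo fun s hs => ?_
    simp only
    rw [integral_const_mul, ← setIntegral_extendSquare_eq_excess hs.2.le]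
    congr 1
    refine setIntegral_congr_fun measurableSet_Ioo fun t ht => ?_
    exact (extendSquare_eq (x := (s, t))
      ⟨Ioo_subset_Icc_self hs, (hs.1.trans ht.1).le, ht.2.le⟩).symm
  have hEd : Continuous fun s => excess f s s := 
    continuous_excess hf continuous_id continuous_id
  have hi : IntegrableOn (fun s => G s * (excess f s s + extendSquare f (s, 1)))
      (Ioo (0 : ℝ) 1) :=
    ((Continuous.continuousOn (by fun_prop)).integrableOn_compact isCompact_Icc).mono_set
      Ioo_subset_Icc_self
  rw [h1, ← integral_sub (integrableOn_boundary hf hGc.continuousOn) hi]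
  refine setIntegral_congr_fun measurableSet_Ioo fun s hs => ?_
  simp only [extendSquare_eq (g := f) (x := (s, 1)) ⟨Ioo_subset_Icc_self hs, by simp⟩]
  ring

theorem integral_triangle_eq_half {f : ℝ × ℝ → ℝ} (hf : IsTypeDensity f) (hS : IsSRS f) :
    ∫ x in triangle, f x = 1 / 2 := by
  have := integral_square_of_symmetric (hf.continuousOn.integrableOn_compact isCompact_square)
    fun x hx => hS.symm x (triangle_subset_square hx)
  rw [hf.integral_eq_one] at this
  linarith

/-- Test with `u = 1`: then `x · ∇u - u = -1`, so the excess on the diagonal has integral `1/2`. -/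
theorem exists_excess_diagonal_pos {f : ℝ × ℝ → ℝ} (hf : IsTypeDensity f) (hS : IsSRS f) :
    ∃ s ∈ Ioo (0 : ℝ) 1, 0 < excess f s s := by
  by_contra! h
  have h1 := integral_triangle_revenue_fst hf (LipschitzWith.const (α := ℝ) (1 : ℝ))
  have h2 : 0 ≤ ∫ s in Ioo (0 : ℝ) 1, -(1 * excess f s s) :=
    setIntegral_nonneg measurableSet_Ioo fun s hs => by linarith [h s hs]
  rw [← h1] at h2
  simp only [fderiv_fun_const, Pi.zero_apply, zero_apply, zero_sub, neg_mul, one_mul,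
    integral_neg] at h2
  linarith [integral_triangle_eq_half hf hS]

theorem exists_excess_diagonal_neg {f : ℝ × ℝ → ℝ} (hf : IsTypeDensity f) (hS : IsSRS f) :
    ∃ s ∈ Ioo (0 : ℝ) 1, excess f s s < 0 := by
  by_contra! h
  -- The test function is `x₁²`, clamped to be Lipschitz. Being homogeneous of degree two, it
  -- satisfies `x · ∇u - u = u`, so its revenue on the triangle is `∫ x₁² f > 0`.
  have hlip : LipschitzWith 2 fun x : ℝ => (max 0 (min 1 x)) ^ 2 := by
    refine LipschitzWith.of_dist_le_mul fun x y => ?_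
    have h1 : LipschitzWith 1 fun x : ℝ => max 0 (min 1 x) :=
      (LipschitzWith.id.const_min 1).const_max 0
    have h2 := h1.dist_le_mul x y
    have a1 : max 0 (min 1 x) ∈ Icc (0 : ℝ) 1 := by simp
    have a2 : max 0 (min 1 y) ∈ Icc (0 : ℝ) 1 := by simp
    simp only [NNReal.coe_one, one_mul, NNReal.coe_ofNat, Real.dist_eq] at h2 ⊢
    generalize max 0 (min 1 x) = a at *
    generalize max 0 (min 1 y) = b at *
    rw [show a ^ 2 - b ^ 2 = (a + b) * (a - b) by ring, abs_mul,
      abs_of_nonneg (add_nonneg a1.1 a2.1)]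
    nlinarith [abs_nonneg (a - b), a1.2, a2.2]
  have h1 := integral_triangle_revenue_fst hf hlip
  have h2 : ∫ s in Ioo (0 : ℝ) 1, -((max 0 (min 1 s)) ^ 2 * excess f s s) ≤ 0 :=
    setIntegral_nonpos measurableSet_Ioo fun s hs =>
      neg_nonpos.2 (mul_nonneg (sq_nonneg _) (h s hs))
  have h3 : ∫ x in triangle, (fderiv ℝ (fun x : ℝ × ℝ => (max 0 (min 1 x.1)) ^ 2) x x -
      (max 0 (min 1 x.1)) ^ 2) * f x = ∫ x in triangle, x.1 ^ 2 * f x := by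
    refine setIntegral_congr_fun measurableSet_triangle fun x hx => ?_
    have hx1 : x.1 ∈ Ioo (0 : ℝ) 1 := (triangle_subset_openSquare hx).1
    have hloc : (fun x : ℝ × ℝ => (max 0 (min 1 x.1)) ^ 2) =ᶠ[nhds x] fun x => x.1 ^ 2 := by
      filter_upwards [isOpen_openSquare.mem_nhds (triangle_subset_openSquare hx)] with y hy
      rw [min_eq_right hy.1.2.le, max_eq_right hy.1.1.le]
    have hd : HasFDerivAt (fun x : ℝ × ℝ => x.1 ^ 2)
        ((2 * x.1 ^ 1) • ContinuousLinearMap.fst ℝ ℝ ℝ) x := by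
      simpa using (hasFDerivAt_fst (𝕜 := ℝ) (p := x)).pow 2
    simp only [hloc.fderiv_eq, hd.fderiv]
    rw [min_eq_right hx1.2.le, max_eq_right hx1.1.le]
    simp only [smul_apply, ContinuousLinearMap.coe_fst', smul_eq_mul]
    ring
  rw [← h1, h3] at h2
  have hnn : 0 ≤ᵐ[volume.restrict triangle] fun x => x.1 ^ 2 * f x :=
    (ae_restrict_iff' measurableSet_triangle).2 (.of_forall fun x hx =>
      mul_nonneg (sq_nonneg _) (hf.nonneg x (triangle_subset_square hx)))
  have hint : IntegrableOn (fun x : ℝ × ℝ => x.1 ^ 2 * f x) triangle :=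
    ((Continuous.continuousOn (by fun_prop)).mul
      hf.continuousOn).integrableOn_compact isCompact_square |>.mono_set triangle_subset_square
  have hz := (integral_eq_zero_iff_of_nonneg_ae hnn hint).1
    (le_antisymm h2 (integral_nonneg_of_ae hnn))
  have : ∫ x in triangle, f x = 0 := by
    refine integral_eq_zero_of_ae ?_
    filter_upwards [hz, ae_restrict_mem measurableSet_triangle] with x hx hxT
    have := hxT.1.ne'
    simpa [this] using hx
  linarith [integral_triangle_eq_half hf hS]

theorem exists_zeta_crossing {f : ℝ × ℝ → ℝ} (hf : IsTypeDensity f) (hS : IsSRS f)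
    (hζ : ConcaveOn ℝ (Icc 0 1) (zeta f)) :
    ∃ m ∈ Ioo (0 : ℝ) 1, (∀ x ∈ Ioo 0 m, x < zeta f x) ∧ ∀ x ∈ Ioo m 1, zeta f x < x := by
  have hc : ContinuousOn (fun x => zeta f x - x) (Icc 0 1) :=
    (continuousOn_zeta hf hS hζ).sub continuousOn_id
  have hk : ConcaveOn ℝ (Icc 0 1) (fun x => zeta f x - x) :=
    hζ.sub (convexOn_id (convex_Icc 0 1))
  have hcomp : IsCompact {x ∈ Icc (0 : ℝ) 1 | 0 ≤ zeta f x - x} :=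
    isCompact_Icc.of_isClosed_subset
      (hc.preimage_isClosed_of_isClosed isClosed_Icc isClosed_Ici) (fun x hx => hx.1)
  have h0 : (0 : ℝ) ∈ {x ∈ Icc (0 : ℝ) 1 | 0 ≤ zeta f x - x} :=
    ⟨by simp, by simpa using (zeta_mem_Icc f 0).1⟩
  have hm := hcomp.sSup_mem ⟨0, h0⟩
  have hmax : ∀ x ∈ Icc (0 : ℝ) 1, 0 ≤ zeta f x - x →
      x ≤ sSup {x ∈ Icc (0 : ℝ) 1 | 0 ≤ zeta f x - x} :=
    fun x hx h => le_csSup hcomp.bddAbove ⟨hx, h⟩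
  generalize sSup {x ∈ Icc (0 : ℝ) 1 | 0 ≤ zeta f x - x} = m at hm hmax
  obtain ⟨hmI, hmζ⟩ := hm
  have hbelow : ∀ x ∈ Icc 0 m, 0 ≤ zeta f x - x := fun x hx => by
    have := hk.min_le_of_mem_Icc h0.1 hmI hx
    exact (le_min h0.2 hmζ).trans this
  have habove : ∀ x ∈ Icc (0 : ℝ) 1, m < x → zeta f x < x := fun x hx h => by
    by_contra! h'
    exact absurd (hmax x hx (by linarith)) (not_le.2 h)
  -- the threshold function cannot lie below the diagonal throughout
  have hnot : ∃ x ∈ Ioo (0 : ℝ) 1, x < zeta f x := by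
    obtain ⟨s, hs, hpos⟩ := exists_excess_diagonal_pos hf hS
    refine ⟨s, hs, ?_⟩
    by_contra! h
    exact absurd (excess_nonpos_of_zeta_le hf (Ioo_subset_Icc_self hs) h hs.2.le) (not_le.2 hpos)
  obtain ⟨x₀, hx₀, hx₀ζ⟩ := hnot
  have hx₀m : x₀ ≤ m := hmax x₀ (Ioo_subset_Icc_self hx₀) (by linarith)
  -- If `m = 1`, the threshold would lie on or above the diagonal throughout, making the excess
  -- nonnegative on all of it.
  have hm1 : m < 1 := by
    by_contra! h
    obtain ⟨s, hs, hneg⟩ := exists_excess_diagonal_neg hf hS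
    have := hbelow s ⟨hs.1.le, hs.2.le.trans h⟩
    exact absurd (excess_nonneg_of_le_zeta hf hS (Ioo_subset_Icc_self hs) (by linarith [hs.1])
      (by linarith)) (not_le.2 hneg)
  refine ⟨m, ⟨hx₀.1.trans_le hx₀m, hm1⟩, fun x hx => ?_,
    fun x hx => habove x ⟨(hmI.1.trans_lt hx.1).le, hx.2.le⟩ hx.1⟩
  have hxI : x ∈ Icc (0 : ℝ) 1 := ⟨hx.1.le, (hx.2.trans hm1).le⟩
  -- The concave function `ζ - id` is nonnegative at 0 and `m` and positive at `x₀`, so comparing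
  -- chord slopes on either side of `x₀` makes it positive throughout `(0,m)`.
  rcases lt_trichotomy x x₀ with h | rfl | h
  · have := hk.slope_anti_adjacent h0.1 (Ioo_subset_Icc_self hx₀) hx.1 h
    by_contra! hle
    have e1 : 0 < (zeta f x₀ - x₀ - (zeta f x - x)) / (x₀ - x) :=
      div_pos (by linarith) (by linarith)
    have e2 : (zeta f x - x - (zeta f 0 - 0)) / (x - 0) ≤ 0 :=
      div_nonpos_of_nonpos_of_nonneg (by linarith [h0.2]) (by linarith [hx.1])
    linarith
  · exact hx₀ζ
  · have := hk.slope_anti_adjacent (Ioo_subset_Icc_self hx₀) hmI h hx.2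
    by_contra! hle
    have e1 : (zeta f x - x - (zeta f x₀ - x₀)) / (x - x₀) < 0 :=
      div_neg_of_neg_of_pos (by linarith) (by linarith)
    have e2 : 0 ≤ (zeta f m - m - (zeta f x - x)) / (m - x) :=
      div_nonneg (by linarith) (by linarith [hx.2])
    linarith

/-- Moving the boundary utility of a symmetric optimal mechanism towards `1 - ζ` below `m` and
upwards above `m` does not change it. -/
theorem eqOn_ubar_of_profit_le {f : ℝ × ℝ → ℝ} (hf : IsTypeDensity f) (hS : IsSRS f)
    {p : square → ℝ} (hopt : IsOptimal f p) (hsymm : IsSymmetric p) {m : ℝ}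
    (hlt : ∀ x ∈ Ioo 0 m, x < zeta f x) (hgt : ∀ x ∈ Ioo m 1, zeta f x < x) {V : ℝ → ℝ}
    (hV : IsBoundaryUtility V)
    (hbelow : ∀ x ∈ Ioo 0 m, (ubar p x < V x → V x ≤ 1 - zeta f x) ∧
      (V x < ubar p x → 1 - zeta f x ≤ V x))
    (habove : ∀ x ∈ Ioo m 1, ubar p x ≤ V x) : ∀ x ∈ Icc (0 : ℝ) 1, V x = ubar p x := by
  have hU := isBoundaryUtility_ubar hopt.1
  have hstrict : ∀ᵐ s ∂volume.restrict (Ioo (0 : ℝ) 1),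
      V s ≠ ubar p s → profit f s (ubar p s) < profit f s (V s) := by
    filter_upwards [ae_restrict_of_ae_restrict_of_subset Ioo_subset_Icc_self
      (ae_excess_strictAntiOn hf hS), ae_restrict_mem measurableSet_Ioo,
      ae_restrict_of_ae (Measure.ae_ne volume m)] with s hanti hs hsm hne
    have hsI := Ioo_subset_Icc_self hs
    rcases lt_or_gt_of_ne hsm with h | h
    · have hs' : s ∈ Ioo 0 m := ⟨hs.1, h⟩
      rcases lt_or_gt_of_ne hne with hV' | hV'
      · exact profit_lt_of_gt hf hS hs hanti hV' ((hbelow s hs').2 hV') (hlt s hs')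
      · exact profit_lt_of_lt hf hS hs (hU.nonneg s hsI) hV' (.inl ((hbelow s hs').1 hV'))
    · have hs' : s ∈ Ioo m 1 := ⟨h, hs.2⟩
      exact profit_lt_of_lt hf hS hs (hU.nonneg s hsI)
        (lt_of_le_of_ne (habove s hs') hne.symm) (.inr (hgt s hs'))
  have hle : (fun s => profit f s (ubar p s)) ≤ᵐ[volume.restrict (Ioo (0 : ℝ) 1)]
      fun s => profit f s (V s) := by
    filter_upwards [hstrict] with s hs
    by_cases h : V s = ubar p s
    · rw [h]
    · exact (hs h).le
  have hint := integral_mono_ae (integrableOn_profit hf hU.continuousOn)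
    (integrableOn_profit hf hV.continuousOn) hle
  -- Optimality gives the reverse inequality of integrals, so the profits agree almost everywhere.
  -- By `hstrict` so do `V` and `ubar p`, and continuity then gives equality everywhere.
  have heq := (integral_eq_iff_of_ae_le (integrableOn_profit hf hU.continuousOn)
    (integrableOn_profit hf hV.continuousOn) hle).1
    (le_antisymm hint (integral_profit_le_of_isOptimal hf hS hopt hsymm hV))
  have hae : V =ᵐ[volume.restrict (Icc (0 : ℝ) 1)] ubar p := by
    rw [← restrict_Ioo_eq_restrict_Icc]
    filter_upwards [heq, hstrict] with s h1 h2
    by_contra h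
    exact (h2 h).ne h1
  exact Measure.eqOn_Icc_of_ae_eq volume zero_ne_one hae hV.continuousOn hU.continuousOn

end TwoGoods

theorem corollary3 (f : ℝ × ℝ → ℝ) (hf : TwoGoods.IsTypeDensity f) (hSRS : TwoGoods.IsSRS f)
    (hζ : ConcaveOn ℝ (Set.Icc 0 1) (TwoGoods.zeta f))
    (p : TwoGoods.square → ℝ) (hopt : TwoGoods.IsOptimal f p) (hsymm : TwoGoods.IsSymmetric p) :
    ∃ b₀ a₁ : ℝ, 0 ≤ b₀ ∧ b₀ ≤ a₁ ∧ a₁ < 1 ∧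
      (∀ x ∈ Set.Ico 0 b₀, HasDerivWithinAt (TwoGoods.ubar p) 0 (Set.Icc 0 1) x) ∧
      (∀ x ∈ Set.Ico b₀ a₁, TwoGoods.ubar p x = 1 - TwoGoods.zeta f x) ∧
      (∀ x ∈ Set.Icc a₁ 1, HasDerivWithinAt (TwoGoods.ubar p) 1 (Set.Icc a₁ 1) x) := by
  obtain ⟨m, hm, hlt, hgt⟩ := TwoGoods.exists_zeta_crossing hf hSRS hζ
  obtain ⟨b₀, a₁, hb, hba, ham, hflat, hmid, hslope⟩ :=
    TwoGoods.exists_pooling_structure (TwoGoods.isBoundaryUtility_ubar hopt.1)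
      (w := fun x => 1 - TwoGoods.zeta f x) ((convexOn_const 1 (convex_Icc 0 1)).sub hζ)
      (continuousOn_const.sub (TwoGoods.continuousOn_zeta hf hSRS hζ))
      (fun x _ => sub_nonneg.2 (TwoGoods.zeta_mem_Icc f x).2) hm
      (fun V hV h1 h2 => TwoGoods.eqOn_ubar_of_profit_le hf hSRS hopt hsymm hlt hgt hV h1 h2)
  refine ⟨b₀, a₁, hb, hba, ham.trans_lt hm.2, fun x hx => ?_, hmid, fun x hx => ?_⟩
  · refine (hasDerivWithinAt_const x (Icc 0 1) (TwoGoods.ubar p 0)).congr_of_eventuallyEq ?_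
      (hflat x (Ico_subset_Icc_self hx))
    filter_upwards [nhdsWithin_le_nhds (isOpen_Iio.mem_nhds hx.2), self_mem_nhdsWithin]
      with y hy hyI using hflat y ⟨hyI.1, le_of_lt hy⟩
  · exact (((hasDerivWithinAt_id x (Icc a₁ 1)).sub_const a₁).const_add
      (TwoGoods.ubar p a₁)).congr hslope (hslope x hx)
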